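/- **Setting.** There are $n\ge 1$ clients; client $i$ holds a local dataset $D_i=(d_{i,1},\dots,d_{i,m})$ of $m\ge1$ samples. For a loss $f(x;z)$, $x\in\mathbb R^d$ ($d\ge1$), put $f_{i,j}(x)=f(x;d_{i,j})$, $f_i=\frac1m\sum_{j}f_{i,j}$ and $f=\frac1n\sum_i f_i$. Assume that for every sample $z$ the function $f(\cdot;z)$ is differentiable, its gradient is $L$-Lipschitz ($L\ge 0$), and $\|\nabla f(x;z)\|\le G$ for all $x$ ($G>0$). A randomized map $\mathcal C:\mathbb R^d\to\mathbb R^d$ is an $\omega$-compressor ($\omega\ge0$) if $\mathbb E[\mathcal C(x)]=x$ and $\mathbb E\|\mathcal C(x)-x\|^2\le\omega\|x\|^2$ for all $x$. **Algorithm CDP-SGD** (initial point $x^0$, stepsize $\eta$, noise level $\sigma_p$, minibatch size $b$, $T$ rounds). In round $t=0,\dots,T-1$ every client $i$ draws a random minibatch $\mathcal I_i^t\subseteq\{1,\dots,m\}$ containing each index independently with probability $b/m$, forms $g_i^t=\frac1b\sum_{j\in\mathcal I_i^t}\nabla f_{i,j}(x^t)+\xi_i^t$ with $\xi_i^t\sim\mathcal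 N(0,\sigma_p^2 I)$, and sends $v_i^t=\mathcal C_i^t(g_i^t)$ to the server, which sets $x^{t+1}=x^t-\eta\,\frac1n\sum_{i=1}^n v_i^t$. Here the $\mathcal C_i^t$ are $\omega$-compressors, and all minibatches, noises and compressors are independent. The algorithm is $(\epsilon,\delta)$-LDP if for every client $i$, all data of the other clients, any two local datasets $D_i,D_i'$ that differ in only one entry, and every measurable set $S$ of possible values of the tuple of all messages $(v_k^t)_{t<T,\,k\le n}$, one has $\Pr_{D_i}\{(v_k^t)\in S\}\le e^{\epsilon}\Pr_{D_i'}\{(v_k^t)\in S\}+\delta$. **Theorem.** For every $K>0$ there are constants $A,c>0$, depending only on $K$, such that the following holds. Let $n,m,d\ge 1$, $L\ge0$, $G>0$, $\omega\ge0$, $\Delta>0$, $\delta\in(0,1)$ and $0<\epsilon\le K\log(1/\delta)$, and put $$R=\frac{\sqrt{nL\Delta}\,m\epsilon}{G\sqrt{(1+\omega)d\log(1/\delta)}}+\frac{m^2\epsilon^2}{d\log(1/\delta)} .$$ There are an integer $T\ge1$ with $R/A\le T\le 1+A\,R$, a stepsize $\eta>0$ and a noise level $\sigma_p>0$, depending only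 on these parameters, such that for every minibatch size $b\in\{1,\dots,m\}$ with $b=m$ or $\epsilon\le c\,(b/m)^2T$, for every loss $f(x;z)$ as above, all $\omega$-compressors $\mathcal C_i^t$ and every initial point $x^0$: 1. CDP-SGD with $T$ rounds is $(\epsilon,\delta)$-LDP; 2. for every dataset such that $f$ is bounded below and $f(x^0)-\inf_x f(x)\le\Delta$, $$\frac1T\sum_{t=0}^{T-1}\mathbb E\|\nabla f(x^t)\|^2\le A\,\frac{G\sqrt{(1+\omega)L\Delta\, d\log(1/\delta)}}{\sqrt n\,m\epsilon}.$$ -/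

import Mathlib

open MeasureTheory ProbabilityTheory

namespace CDPSGD

/-- The space of model parameters, with its Euclidean norm. -/
abbrev Vec (d : ℕ) := EuclideanSpace ℝ (Fin d)

/-! ### Loss functions -/

/-- `f` is `L`-smooth: differentiable, with an `L`-Lipschitz gradient. -/
def IsSmooth {d : ℕ} (L : ℝ) (f : Vec d → ℝ) : Prop :=
  Differentiable ℝ f ∧ ∀ x y, ‖gradient f x - gradient f y‖ ≤ L * ‖x - y‖

/-- The gradient of `f` is bounded by `G` in norm. -/
def HasBoundedGradient {d : ℕ} (G : ℝ) (f : Vec d → ℝ) : Prop :=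
  ∀ x, ‖gradient f x‖ ≤ G

/-- The local objective of a client with dataset `D`; `f z x` is the loss of the model `x`
on the data sample `z`. -/
noncomputable def localLoss {Z : Type*} {d m : ℕ} (f : Z → Vec d → ℝ) (D : Fin m → Z)
    (x : Vec d) : ℝ :=
  (1 / (m : ℝ)) * ∑ j, f (D j) x

/-- The global objective; `D i` is the local dataset of client `i`. -/
noncomputable def globalLoss {Z : Type*} {d n m : ℕ} (f : Z → Vec d → ℝ)
    (D : Fin n → Fin m → Z) (x : Vec d) : ℝ :=
  (1 / (n : ℝ)) * ∑ i, localLoss f (D i) x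

/-! ### Compression operators -/

/-- A randomized `ω`-compression operator on `ℝ^d`: a Markov kernel `C` (so `C x` is the law of the
random output on the input `x`) with `E[C(x)] = x` and `E‖C(x) - x‖² ≤ ω ‖x‖²` for all `x`. -/
structure Compressor (d : ℕ) (ω : ℝ) where
  kernel : Kernel (Vec d) (Vec d)
  isMarkov : IsMarkovKernel kernel
  integrable : ∀ x, Integrable (fun y => y) (kernel x)
  mean_eq : ∀ x, ∫ y, y ∂(kernel x) = x
  integrable_sq : ∀ x, Integrable (fun y => ‖y - x‖ ^ 2) (kernel x)
  variance_le : ∀ x, ∫ y, ‖y - x‖ ^ 2 ∂(kernel x) ≤ ω * ‖x‖ ^ 2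

instance {d : ℕ} {ω : ℝ} (C : Compressor d ω) : IsMarkovKernel C.kernel := C.isMarkov

/-! ### Local differential privacy -/

/-- Two local datasets are neighbors if they differ in at most one entry. -/
def Neighbors {Z : Type*} {m : ℕ} (D D' : Fin m → Z) : Prop :=
  ∃ j, ∀ k, k ≠ j → D k = D' k

/-- `(ε, δ)`-differential privacy of the randomized mechanism `M` of a local dataset; `M D` is the
law of its output on the dataset `D`. -/
def IsLDP {Z R : Type*} {m : ℕ} [MeasurableSpace R] (ε δ : ℝ) (M : (Fin m → Z) → Measure R) :
    Prop :=
  ∀ D D', Neighbors D D' → ∀ S, MeasurableSet S →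
    M D S ≤ ENNReal.ofReal (Real.exp ε) * M D' S + ENNReal.ofReal δ

/-! ### The algorithm -/

/-- The law of a random minibatch, coded by its indicator function: each of the `m` samples is
included independently with probability `b / m` (for `b ≤ m`). -/
noncomputable def minibatchLaw (b m : ℕ) : Measure (Fin m → Bool) :=
  Measure.pi fun _ =>
    bernoulliMeasure true false (Set.projIcc (0 : ℝ) 1 zero_le_one ((b : ℝ) / (m : ℝ)))

instance (b m : ℕ) : IsProbabilityMeasure (minibatchLaw b m) := by
  unfold minibatchLaw; infer_instance

/-- The Gaussian law `N(0, σ² I)` on `ℝ^d`. -/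
noncomputable def noiseLaw (d : ℕ) (σ : ℝ) : Measure (Vec d) :=
  (stdGaussian (Vec d)).map fun ξ => σ • ξ

instance (d : ℕ) (σ : ℝ) : IsProbabilityMeasure (noiseLaw d σ) :=
  Measure.isProbabilityMeasure_map (by fun_prop)

/-- The minibatch gradient `(1/b) ∑_{j ∈ S} ∇f(x; D_j)` on the minibatch with indicator `S`. -/
noncomputable def stochGrad {Z : Type*} {d m : ℕ} (f : Z → Vec d → ℝ) (D : Fin m → Z) (b : ℕ)
    (x : Vec d) (S : Fin m → Bool) : Vec d :=
  (1 / (b : ℝ)) • ∑ j, if S j then gradient (f (D j)) x else 0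

lemma measurable_gradient {d : ℕ} (f : Vec d → ℝ) : Measurable (gradient f) :=
  (InnerProductSpace.toDual ℝ (Vec d)).symm.continuous.measurable.comp (measurable_fderiv ℝ f)

lemma measurable_perturbedGrad {Z : Type*} {d m : ℕ} (f : Z → Vec d → ℝ) (D : Fin m → Z)
    (b : ℕ) : Measurable fun p : Vec d × ((Fin m → Bool) × Vec d) =>
      stochGrad f D b p.1 p.2.1 + p.2.2 := by
  unfold stochGrad
  refine Measurable.add (Measurable.fun_const_smul
    (Finset.measurable_fun_sum Finset.univ fun j _ => ?_) _) (by fun_prop)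
  refine Measurable.ite ?_ ((measurable_gradient _).comp measurable_fst) measurable_const
  exact (show Measurable fun p : Vec d × ((Fin m → Bool) × Vec d) => p.2.1 j by fun_prop)
    (measurableSet_singleton true)

/-- Local computation and privacy step: `x` is sent to the law of `g̃ + ξ`, where `g̃` is a minibatch
gradient at `x` and `ξ ∼ N(0, σ² I)` is independent of the minibatch. -/
noncomputable def perturbedGradKernel {Z : Type*} {d m : ℕ} (f : Z → Vec d → ℝ) (D : Fin m → Z)
    (b : ℕ) (σ : ℝ) : Kernel (Vec d) (Vec d) :=
  (Kernel.id ×ₖ Kernel.const _ ((minibatchLaw b m).prod (noiseLaw d σ))).map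
    fun p => stochGrad f D b p.1 p.2.1 + p.2.2

instance {Z : Type*} {d m : ℕ} (f : Z → Vec d → ℝ) (D : Fin m → Z) (b : ℕ) (σ : ℝ) :
    IsMarkovKernel (perturbedGradKernel f D b σ) :=
  Kernel.IsMarkovKernel.map _ (measurable_perturbedGrad f D b)

/-- Direct compression: `x` is sent to the law of the message `C(g̃ + ξ)` of one client. -/
noncomputable def messageKernel {Z : Type*} {d m : ℕ} {ω : ℝ} (f : Z → Vec d → ℝ) (D : Fin m → Z)
    (b : ℕ) (σ : ℝ) (C : Compressor d ω) : Kernel (Vec d) (Vec d) :=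
  C.kernel ∘ₖ perturbedGradKernel f D b σ

instance {Z : Type*} {d m : ℕ} {ω : ℝ} (f : Z → Vec d → ℝ) (D : Fin m → Z) (b : ℕ) (σ : ℝ)
    (C : Compressor d ω) : IsMarkovKernel (messageKernel f D b σ C) := by
  unfold messageKernel; infer_instance

/-- One communication round: `x` is sent to the joint law of the messages of the `n` clients, which
are independent given `x`; `C i` is the compressor of client `i` in this round. -/
noncomputable def roundKernel {Z : Type*} {d n m : ℕ} {ω : ℝ} (f : Z → Vec d → ℝ)
    (D : Fin n → Fin m → Z) (b : ℕ) (σ : ℝ) (C : Fin n → Compressor d ω) :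
    Kernel (Vec d) (Fin n → Vec d) where
  toFun x := Measure.pi fun i => messageKernel f (D i) b σ (C i) x
  measurable' := by
    refine Measurable.measure_of_isPiSystem_of_isProbabilityMeasure
      generateFrom_pi.symm isPiSystem_pi ?_
    rintro _ ⟨s, hs, rfl⟩
    simp only [Measure.pi_pi]
    exact Finset.measurable_fun_prod _ fun i _ =>
      Kernel.measurable_coe _ (hs i (Set.mem_univ i))

instance {Z : Type*} {d n m : ℕ} {ω : ℝ} (f : Z → Vec d → ℝ) (D : Fin n → Fin m → Z) (b : ℕ)
    (σ : ℝ) (C : Fin n → Compressor d ω) : IsMarkovKernel (roundKernel f D b σ C) :=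
  ⟨fun x => by
    change IsProbabilityMeasure (Measure.pi fun i => messageKernel f (D i) b σ (C i) x)
    infer_instance⟩

/-- The model `x^t = x^0 - ∑_{s < t} η_s v^s` that the server holds after the messages `h s i`
(`s < t`, client `i`), where `v^s` is the average of the messages of round `s`. -/
noncomputable def model {d n : ℕ} (η : ℕ → ℝ) (x0 : Vec d) {t : ℕ} (h : Fin t → Fin n → Vec d) :
    Vec d :=
  x0 - ∑ s : Fin t, η s • ((1 / (n : ℝ)) • ∑ i, h s i)

lemma measurable_model {d n : ℕ} (η : ℕ → ℝ) (x0 : Vec d) (t : ℕ) :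
    Measurable fun h : Fin t → Fin n → Vec d => model η x0 h := by
  unfold model; fun_prop

/-- The joint law of all messages sent to the server in the first `T` rounds (rounds
`0, …, T - 1`): given the messages of the rounds before `t`, those of round `t` have the law
`roundKernel` at the current model `x^t`. -/
noncomputable def transcriptLaw {Z : Type*} {d n m : ℕ} {ω : ℝ} (f : Z → Vec d → ℝ)
    (D : Fin n → Fin m → Z) (b : ℕ) (η : ℕ → ℝ) (σ : ℝ) (C : ℕ → Fin n → Compressor d ω)
    (x0 : Vec d) : (T : ℕ) → Measure (Fin T → Fin n → Vec d)
  | 0 => Measure.dirac fun s => s.elim0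
  | t + 1 =>
    ((transcriptLaw f D b η σ C x0 t) ⊗ₘ
        ((roundKernel f D b σ (C t)).comap (model η x0) (measurable_model η x0 t))).map
      fun p => Fin.snoc (α := fun _ => Fin n → Vec d) p.1 p.2

/-- The utility `(1/T) ∑_{t < T} E ‖∇f(x^t)‖²`. -/
noncomputable def avgSqGradNorm {Z : Type*} {d n m : ℕ} {ω : ℝ} (f : Z → Vec d → ℝ)
    (D : Fin n → Fin m → Z) (b : ℕ) (η : ℕ → ℝ) (σ : ℝ) (C : ℕ → Fin n → Compressor d ω)
    (x0 : Vec d) (T : ℕ) : ℝ :=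
  (1 / (T : ℝ)) * ∑ t ∈ Finset.range T,
    ∫ h, ‖gradient (globalLoss f D) (model η x0 h)‖ ^ 2 ∂(transcriptLaw f D b η σ C x0 t)

/-- The order of the number of communication rounds. -/
noncomputable def roundOrder (n m d : ℕ) (L G ω ε δ Δ : ℝ) : ℝ :=
  √(n * L * Δ) * m * ε / (G * √((1 + ω) * d * Real.log (1 / δ)))
    + m ^ 2 * ε ^ 2 / (d * Real.log (1 / δ))

/-- The order of the average squared gradient norm. -/
noncomputable def utilityOrder (n m d : ℕ) (L G ω ε δ Δ : ℝ) : ℝ :=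
  G * √((1 + ω) * L * Δ * d * Real.log (1 / δ)) / (√n * m * ε)

end CDPSGD

namespace CDPSGD

open scoped ENNReal

/-! The two claims are proved separately and meet only in the choice of `T`, `η` and `σ`.

Privacy. The Rényi divergence of order `α` is handled through its dual, the inequality `∫ g dμ ≤ C
(∫ g ^ p dν) ^ (1 / p)` with `p = α / (α - 1)`. In this form no density of the transcript is ever
needed: constants multiply under adaptive composition (`HolderDominated.compProd`), a common kernel
costs nothing (`HolderDominated.bind`), so compression and the messages of other clients are free,
and weighted AM-GM turns the inequality into an `(ε, δ)` bound (`HolderDominated.measure_le`). For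
one round, conditioning on the rest of the minibatch leaves a Bernoulli(`q`) mixture of two
Gaussians, `q = b / m`. Its density against the standard Gaussian has positive and negative moments
of order `k` bounded by `exp (O(k² q² v))`, where `v = (G / (b σ))²` (`lintegral_mixDensity_pow_le`,
`lintegral_mixDensity_inv_pow_le`). Since `q² v = (G / (m σ))²`, the privacy cost, and hence the
noise level, does not depend on `b`.

Utility. The averaged message is an unbiased estimate of the gradient with variance at most `(1 +
ω)(2 G² + d σ²) / n` (`hasMoments_roundKernel`), and the descent lemma telescopes
(`avgSqGradNorm_le`). With `σ²` proportional to `T` and `η` to `1 / T`, the noise contribution and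
the contribution of `Δ` are independent of `T` and both of the order claimed. The first term of `R`
ensures `η L ≤ 1`; the second ensures `G² ≤ d σ²`, so the sampling error is dominated by the privacy
noise. -/

/-! ### Hölder domination of measures -/

/-- `μ` is dominated by `ν` with exponent `p` and constant `C`: `∫ g dμ ≤ C (∫ g ^ p dν) ^ (1 / p)`
for all measurable `g ≥ 0`. For `p > 1` this is the dual form of the bound `‖dμ/dν‖ ≤ C` in
`L^α(ν)`, `α` being the conjugate exponent, i.e. of a bound of the Rényi divergence of order `α`. -/
def HolderDominated {X : Type*} [MeasurableSpace X] (p : ℝ) (C : ℝ≥0∞) (μ ν : Measure X) : Prop :=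
  ∀ g : X → ℝ≥0∞, Measurable g → ∫⁻ x, g x ∂μ ≤ C * (∫⁻ x, g x ^ p ∂ν) ^ (1 / p)

lemma lintegral_le_rpow_lintegral {X : Type*} [MeasurableSpace X] (μ : Measure X)
    [IsProbabilityMeasure μ] {p : ℝ} (hp : 1 < p) {g : X → ℝ≥0∞} (hg : Measurable g) :
    ∫⁻ x, g x ∂μ ≤ (∫⁻ x, g x ^ p ∂μ) ^ (1 / p) := by
  have h := ENNReal.lintegral_mul_le_Lp_mul_Lq μ (Real.HolderConjugate.conjExponent hp)
    hg.aemeasurable (g := fun _ => 1) aemeasurable_const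
  simpa using h

lemma lintegral_rpow_one_div_le {X : Type*} [MeasurableSpace X] (μ : Measure X)
    [IsProbabilityMeasure μ] {p : ℝ} (hp : 1 < p) {g : X → ℝ≥0∞} (hg : Measurable g) :
    ∫⁻ x, g x ^ (1 / p) ∂μ ≤ (∫⁻ x, g x ∂μ) ^ (1 / p) := by
  have h := lintegral_le_rpow_lintegral μ hp (hg.pow_const (1 / p))
  have h0 : p ≠ 0 := by linarith
  simpa [← ENNReal.rpow_mul, inv_mul_cancel₀ h0] using h

namespace HolderDominated

variable {X Y W : Type*} [MeasurableSpace X] [MeasurableSpace Y] [MeasurableSpace W]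
  {p : ℝ} {C C' : ℝ≥0∞} {μ ν : Measure X}

lemma refl (hp : 1 < p) (μ : Measure X) [IsProbabilityMeasure μ] : HolderDominated p 1 μ μ :=
  fun g hg => by simpa using lintegral_le_rpow_lintegral μ hp hg

lemma map (h : HolderDominated p C μ ν) {f : X → Y} (hf : Measurable f) :
    HolderDominated p C (μ.map f) (ν.map f) := fun g hg => by
  rw [lintegral_map hg hf, lintegral_map (hg.pow_const p) hf]
  exact h _ (hg.comp hf)

/-- Adaptive composition. The conditional bound leaves `(∫ g ^ p) ^ (1 / p)` as a function of the
first coordinate; its `p`-th power is the inner integral again, so the bound for `μ` and `ν` applies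
to it without loss. -/
lemma compProd (hp : 1 < p) [SFinite μ] [SFinite ν] (h : HolderDominated p C μ ν)
    {κ κ' : Kernel X Y} [IsSFiniteKernel κ] [IsSFiniteKernel κ']
    (hκ : ∀ x, HolderDominated p C' (κ x) (κ' x)) :
    HolderDominated p (C * C') (μ ⊗ₘ κ) (ν ⊗ₘ κ') := fun g hg => by
  rw [Measure.lintegral_compProd hg, Measure.lintegral_compProd (hg.pow_const p)]
  have hm : Measurable fun x => ∫⁻ y, g (x, y) ^ p ∂(κ' x) :=
    (hg.pow_const p).lintegral_kernel_prod_right'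
  have h0 : p ≠ 0 := by linarith
  calc ∫⁻ x, ∫⁻ y, g (x, y) ∂κ x ∂μ
      ≤ ∫⁻ x, C' * (∫⁻ y, g (x, y) ^ p ∂(κ' x)) ^ (1 / p) ∂μ :=
        lintegral_mono fun x => hκ x _ (hg.comp measurable_prodMk_left)
    _ = C' * ∫⁻ x, (∫⁻ y, g (x, y) ^ p ∂(κ' x)) ^ (1 / p) ∂μ :=
        lintegral_const_mul _ (hm.pow_const _)
    _ ≤ C' * (C * (∫⁻ x, ((∫⁻ y, g (x, y) ^ p ∂(κ' x)) ^ (1 / p)) ^ p ∂ν) ^ (1 / p)) := by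
        gcongr; exact h _ (hm.pow_const _)
    _ = _ := by
        simp_rw [← ENNReal.rpow_mul, one_div, inv_mul_cancel₀ h0, ENNReal.rpow_one]
        ring

/-- Data processing: composing with the same kernel on both sides has constant `1`, and the first
coordinate is then forgotten. -/
lemma bind (hp : 1 < p) [SFinite μ] [SFinite ν] (h : HolderDominated p C μ ν)
    (κ : Kernel X Y) [IsMarkovKernel κ] : HolderDominated p C (κ ∘ₘ μ) (κ ∘ₘ ν) := by
  have := (h.compProd hp (κ := κ) (κ' := κ) fun x => refl hp (κ x)).map measurable_snd
  rwa [← Measure.snd, ← Measure.snd, Measure.snd_compProd, Measure.snd_compProd, mul_one] at this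

lemma prod (hp : 1 < p) [SFinite μ] [SFinite ν] (h : HolderDominated p C μ ν) (ρ : Measure Y)
    [IsProbabilityMeasure ρ] : HolderDominated p C (μ.prod ρ) (ν.prod ρ) := by
  rw [← Measure.compProd_const, ← Measure.compProd_const, ← mul_one C]
  exact h.compProd hp fun x => refl hp _

/-- Domination of the conditional laws given an independent `x` implies domination. -/
lemma map_prod (hp : 1 < p) {ρ : Measure X} [IsProbabilityMeasure ρ] {τ : Measure Y} [SFinite τ]
    {φ φ' : X × Y → W} (hφ : Measurable φ) (hφ' : Measurable φ')
    (h : ∀ x, HolderDominated p C (τ.map fun y => φ (x, y)) (τ.map fun y => φ' (x, y))) :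
    HolderDominated p C ((ρ.prod τ).map φ) ((ρ.prod τ).map φ') := fun g hg => by
  rw [lintegral_map hg hφ, lintegral_map (hg.pow_const p) hφ',
    lintegral_prod (fun a => g (φ a)) (hg.comp hφ).aemeasurable,
    lintegral_prod (fun a => g (φ' a) ^ p) ((hg.pow_const p).comp hφ').aemeasurable]
  have hm : Measurable fun x => ∫⁻ y, g (φ' (x, y)) ^ p ∂τ :=
    ((hg.pow_const p).comp hφ').lintegral_prod_right'
  calc ∫⁻ x, ∫⁻ y, g (φ (x, y)) ∂τ ∂ρ
      ≤ ∫⁻ x, C * (∫⁻ y, g (φ' (x, y)) ^ p ∂τ) ^ (1 / p) ∂ρ := by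
        refine lintegral_mono fun x => ?_
        have := h x g hg
        rwa [lintegral_map hg (by fun_prop), lintegral_map (hg.pow_const p) (by fun_prop)] at this
    _ = C * ∫⁻ x, (∫⁻ y, g (φ' (x, y)) ^ p ∂τ) ^ (1 / p) ∂ρ :=
        lintegral_const_mul _ (hm.pow_const _)
    -- Jensen for the concave power `1 / p`. This works because `x` has the same law `ρ` on both
    -- sides.
    _ ≤ _ := by gcongr; exact lintegral_rpow_one_div_le ρ hp hm

lemma pi {n : ℕ} {E : Type*} [MeasurableSpace E] (hp : 1 < p) {μ ν : Fin n → Measure E}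
    [∀ k, IsProbabilityMeasure (μ k)] [∀ k, IsProbabilityMeasure (ν k)] (i : Fin n)
    (hne : ∀ k, k ≠ i → μ k = ν k) (h : HolderDominated p C (μ i) (ν i)) :
    HolderDominated p C (Measure.pi μ) (Measure.pi ν) := by
  obtain _ | n := n
  · exact i.elim0
  have key := fun μ : Fin (n + 1) → Measure E => fun _ : ∀ k, IsProbabilityMeasure (μ k) =>
    ((measurePreserving_piFinSuccAbove μ i).symm).map_eq
  rw [← key μ inferInstance, ← key ν inferInstance]
  have : (fun j => μ (i.succAbove j)) = fun j => ν (i.succAbove j) :=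
    funext fun j => hne _ (i.succAbove_ne j)
  rw [this]
  exact (h.prod hp _).map (MeasurableEquiv.measurable _)

/-- Testing the domination on the indicator of `S` gives `μ S ≤ C (ν S) ^ (1 / p)`; AM-GM with
weights `1 / p` and `1 - 1 / p` on `e ^ ε ν S` and `δ` then separates the two terms. -/
lemma measure_le {C ε δ : ℝ} (hp : 1 < p) (h : HolderDominated p (ENNReal.ofReal C) μ ν)
    [IsProbabilityMeasure ν] (hδ : 0 < δ)
    (hC : C ≤ Real.exp (ε * (1 / p)) * δ ^ (1 - 1 / p)) {S : Set X} (hS : MeasurableSet S) :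
    μ S ≤ ENNReal.ofReal (Real.exp ε) * ν S + ENNReal.ofReal δ := by
  have h0 : 0 < p := by linarith
  have h1 := h (S.indicator fun _ => 1) (measurable_const.indicator hS)
  have h2 : ∀ x, S.indicator (fun _ => (1 : ℝ≥0∞)) x ^ p = S.indicator (fun _ => 1) x := fun x => by
    by_cases hx : x ∈ S <;> simp [hx, h0]
  simp_rw [h2] at h1
  rw [lintegral_indicator_const hS, lintegral_indicator_const hS, one_mul, one_mul] at h1
  refine h1.trans ?_
  have hlt : 1 / p < 1 := by rw [div_lt_one h0]; exact hp
  have h3 : 0 < 1 / p := by positivity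
  rw [← ofReal_measureReal (μ := ν) (s := S), ENNReal.ofReal_rpow_of_nonneg measureReal_nonneg h3.le,
    ← ENNReal.ofReal_mul' (by positivity), ← ENNReal.ofReal_mul (by positivity),
    ← ENNReal.ofReal_add (by positivity) hδ.le]
  refine ENNReal.ofReal_le_ofReal ?_
  have h4 := Real.geom_mean_le_arith_mean2_weighted h3.le (sub_nonneg.2 hlt.le)
    (mul_nonneg (Real.exp_pos ε).le (measureReal_nonneg (μ := ν) (s := S))) hδ.le (by ring)
  rw [Real.mul_rpow (Real.exp_pos ε).le measureReal_nonneg, ← Real.exp_mul] at h4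
  calc C * ν.real S ^ (1 / p)
      ≤ Real.exp (ε * (1 / p)) * δ ^ (1 - 1 / p) * ν.real S ^ (1 / p) := by gcongr
    _ ≤ 1 / p * (Real.exp ε * ν.real S) + (1 - 1 / p) * δ := by linarith
    _ ≤ 1 * (Real.exp ε * ν.real S) + 1 * δ := by gcongr; linarith
    _ = _ := by ring

end HolderDominated

/-! ### Translations of the standard Gaussian measure -/

/-- The density of `N(u, I)` with respect to `N(0, I)`. -/
noncomputable def shiftDensity {d : ℕ} (u z : Vec d) : ℝ :=
  Real.exp (inner ℝ u z - ‖u‖ ^ 2 / 2)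

lemma shiftDensity_pos {d : ℕ} (u z : Vec d) : 0 < shiftDensity u z := Real.exp_pos _

lemma measurable_shiftDensity {d : ℕ} (u : Vec d) : Measurable (shiftDensity u) := by
  unfold shiftDensity; fun_prop

lemma integrable_shiftDensity {d : ℕ} (u : Vec d) :
    Integrable (shiftDensity u) (stdGaussian (Vec d)) := by
  have h : Integrable (fun x : Fin d → ℝ => ∏ i, Real.exp (u i * x i))
      (Measure.pi fun _ => gaussianReal 0 1) :=
    Integrable.fintype_prod fun i => integrable_exp_mul_gaussianReal (u i)
  unfold shiftDensity
  simp_rw [Real.exp_sub]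
  refine Integrable.div_const ?_ _
  rw [← map_pi_eq_stdGaussian, integrable_map_measure (by fun_prop) (by fun_prop)]
  refine h.congr (ae_of_all _ fun x => ?_)
  simp [PiLp.inner_apply, ← Real.exp_sum, mul_comm]

/-- Cameron–Martin by comparison of characteristic functions: in coordinates the integral factors
into one-dimensional complex exponential moments `E exp ((u i + t i I) x) = exp ((u i + t i I)² /
2)`. -/
lemma stdGaussian_withDensity_shiftDensity {d : ℕ} (u : Vec d) :
    (stdGaussian (Vec d)).withDensity (fun z => ENNReal.ofReal (shiftDensity u z))
      = (stdGaussian (Vec d)).map (· + u) := by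
  have : IsFiniteMeasure ((stdGaussian (Vec d)).withDensity
      fun z => ENNReal.ofReal (shiftDensity u z)) :=
    isFiniteMeasure_withDensity_ofReal (integrable_shiftDensity u).2
  refine Measure.ext_of_charFun (funext fun t => ?_)
  rw [charFun_map_add_const, charFun_stdGaussian, charFun_apply,
    integral_withDensity_eq_integral_toReal_smul (measurable_shiftDensity u).ennreal_ofReal
      (by simp), ← map_pi_eq_stdGaussian, integral_map (by fun_prop)
      (by have := measurable_shiftDensity u; fun_prop)]
  have h1 : ∀ x : Fin d → ℝ, (ENNReal.ofReal (shiftDensity u (WithLp.toLp 2 x))).toReal •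
      Complex.exp (inner ℝ (WithLp.toLp 2 x) t * Complex.I) =
      Complex.exp (-(‖u‖ : ℂ) ^ 2 / 2) *
        ∏ i, Complex.exp ((u i + t i * Complex.I) * x i) := fun x => by
    rw [ENNReal.toReal_ofReal (shiftDensity_pos _ _).le, ← Complex.exp_sum, ← Complex.exp_add,
      Complex.real_smul, shiftDensity, Complex.ofReal_exp, ← Complex.exp_add]
    congr 1
    simp only [PiLp.inner_apply, RCLike.inner_apply, conj_trivial, Complex.ofReal_sub,
      Complex.ofReal_sum, Complex.ofReal_mul, Complex.ofReal_div, Complex.ofReal_pow,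
      Complex.ofReal_ofNat, add_mul, Finset.sum_add_distrib, Finset.sum_mul]
    rw [neg_div, sub_add_eq_add_sub, sub_eq_neg_add]
    congr 2
    · exact Finset.sum_congr rfl fun i _ => by ring
    · exact Finset.sum_congr rfl fun i _ => by ring
  have h2 : ∀ z : ℂ, ∫ x : ℝ, Complex.exp (z * x) ∂(gaussianReal 0 1) = Complex.exp (z ^ 2 / 2) :=
    fun z => by simpa [complexMGF] using complexMGF_id_gaussianReal (μ := 0) (v := 1) z
  simp_rw [h1]
  rw [integral_const_mul, integral_fintype_prod_eq_prod
    (f := fun i (x : ℝ) => Complex.exp ((u i + t i * Complex.I) * x))]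
  simp_rw [h2]
  rw [← Complex.exp_sum, ← Complex.exp_add, ← Complex.exp_add]
  congr 1
  have hu : (‖u‖ : ℂ) ^ 2 = ∑ i, (u i : ℂ) ^ 2 := by
    rw [← Complex.ofReal_pow, EuclideanSpace.real_norm_sq_eq]; push_cast; rfl
  have ht : (‖t‖ : ℂ) ^ 2 = ∑ i, (t i : ℂ) ^ 2 := by
    rw [← Complex.ofReal_pow, EuclideanSpace.real_norm_sq_eq]; push_cast; rfl
  have hut : ((inner ℝ u t : ℝ) : ℂ) = ∑ i, (u i : ℂ) * t i := by
    simp [PiLp.inner_apply, mul_comm]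
  rw [hu, ht, hut, ← Finset.sum_neg_distrib, ← Finset.sum_neg_distrib, Finset.sum_div,
    Finset.sum_div, Finset.sum_mul, ← Finset.sum_add_distrib, ← Finset.sum_add_distrib]
  refine Finset.sum_congr rfl fun i _ => ?_
  ring_nf
  rw [Complex.I_sq]
  ring

lemma lintegral_add_stdGaussian {d : ℕ} (u : Vec d) {g : Vec d → ℝ≥0∞} (hg : Measurable g) :
    ∫⁻ z, g (z + u) ∂(stdGaussian (Vec d))
      = ∫⁻ z, ENNReal.ofReal (shiftDensity u z) * g z ∂(stdGaussian (Vec d)) := by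
  rw [← lintegral_map hg (measurable_add_const u), ← stdGaussian_withDensity_shiftDensity,
    lintegral_withDensity_eq_lintegral_mul _ (measurable_shiftDensity u).ennreal_ofReal hg]
  rfl

lemma integral_shiftDensity {d : ℕ} (u : Vec d) :
    ∫ z, shiftDensity u z ∂(stdGaussian (Vec d)) = 1 := by
  rw [integral_eq_lintegral_of_nonneg_ae (ae_of_all _ fun z => (shiftDensity_pos u z).le)
    (measurable_shiftDensity u).aestronglyMeasurable]
  have := lintegral_add_stdGaussian u (g := fun _ => 1) measurable_const
  simp only [lintegral_const, measure_univ, mul_one] at this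
  rw [← this, ENNReal.toReal_one]

/-- The powers of the density, with a real exponent, are multiples of such densities. -/
lemma shiftDensity_rpow {d : ℕ} (u z : Vec d) (s : ℝ) :
    shiftDensity u z ^ s = Real.exp (s * (s - 1) / 2 * ‖u‖ ^ 2) * shiftDensity (s • u) z := by
  rw [shiftDensity, shiftDensity, ← Real.exp_mul, ← Real.exp_add, norm_smul, mul_pow,
    Real.norm_eq_abs, sq_abs, real_inner_smul_left]
  congr 1
  ring

lemma integrable_shiftDensity_rpow {d : ℕ} (u : Vec d) (s : ℝ) :
    Integrable (fun z => shiftDensity u z ^ s) (stdGaussian (Vec d)) := by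
  simp_rw [shiftDensity_rpow]
  exact (integrable_shiftDensity _).const_mul _

lemma integral_shiftDensity_rpow {d : ℕ} (u : Vec d) (s : ℝ) :
    ∫ z, shiftDensity u z ^ s ∂(stdGaussian (Vec d)) = Real.exp (s * (s - 1) / 2 * ‖u‖ ^ 2) := by
  simp_rw [shiftDensity_rpow]
  rw [integral_const_mul, integral_shiftDensity, mul_one]

lemma lintegral_shiftDensity_rpow {d : ℕ} (u : Vec d) (s : ℝ) :
    ∫⁻ z, ENNReal.ofReal (shiftDensity u z ^ s) ∂(stdGaussian (Vec d))
      = ENNReal.ofReal (Real.exp (s * (s - 1) / 2 * ‖u‖ ^ 2)) := by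
  rw [← integral_shiftDensity_rpow, ofReal_integral_eq_lintegral_ofReal
    (integrable_shiftDensity_rpow u s)
    (ae_of_all _ fun z => Real.rpow_nonneg (shiftDensity_pos u z).le s)]

/-! ### Moments of the density of the subsampled Gaussian law -/

/-- The mean of `h` under the binomial law with parameters `k` and `q`. -/
def binomMean (q : ℝ) : ℕ → (ℕ → ℝ) → ℝ
  | 0, h => h 0
  | k + 1, h => binomMean q k fun i => (1 - q) * h i + q * h (i + 1)

lemma binomMean_mono {q : ℝ} (hq0 : 0 ≤ q) (hq1 : q ≤ 1) (k : ℕ) :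
    ∀ {h h' : ℕ → ℝ}, (∀ i ≤ k, h i ≤ h' i) → binomMean q k h ≤ binomMean q k h' := by
  induction k with
  | zero => exact fun H => H 0 le_rfl
  | succ k ih =>
    refine fun H => ih fun i hi => ?_
    have := sub_nonneg.2 hq1
    gcongr
    · exact H i (by omega)
    · exact H (i + 1) (by omega)

lemma binomMean_const_mul (q c : ℝ) (k : ℕ) :
    ∀ h : ℕ → ℝ, binomMean q k (fun i => c * h i) = c * binomMean q k h := by
  induction k with
  | zero => exact fun h => rfl
  | succ k ih =>
    intro h
    rw [binomMean, binomMean, ← ih]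
    congr 1
    funext i
    ring

/-- Expands a power of the mixture density into powers of `shiftDensity`, whose Gaussian moments are
explicit. The recursive form of `binomMean` replaces binomial coefficients by induction. -/
lemma binomMean_pow (q x : ℝ) (k : ℕ) : binomMean q k (fun i => x ^ i) = (1 - q + q * x) ^ k := by
  induction k with
  | zero => simp [binomMean]
  | succ k ih =>
    rw [binomMean, pow_succ', ← ih, ← binomMean_const_mul]
    congr 1
    funext i
    ring

lemma integral_binomMean {X : Type*} [MeasurableSpace X] (μ : Measure X) (q : ℝ) (k : ℕ) :
    ∀ {h : ℕ → X → ℝ}, (∀ i, Integrable (h i) μ) →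
      Integrable (fun x => binomMean q k fun i => h i x) μ ∧
      ∫ x, binomMean q k (fun i => h i x) ∂μ = binomMean q k fun i => ∫ x, h i x ∂μ := by
  induction k with
  | zero => exact fun H => ⟨H 0, rfl⟩
  | succ k ih =>
    intro h H
    have H1 : ∀ i, Integrable (fun x => (1 - q) * h i x + q * h (i + 1) x) μ := fun i =>
      ((H i).const_mul _).add ((H (i + 1)).const_mul _)
    refine ⟨(ih H1).1, (ih H1).2.trans ?_⟩
    rw [binomMean]
    congr 1
    funext i
    rw [integral_add ((H i).const_mul _) ((H (i + 1)).const_mul _), integral_const_mul,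
      integral_const_mul]

lemma one_sub_add_mul_exp_le {q y : ℝ} (hq : 0 ≤ q) (hy0 : 0 ≤ y) (hy1 : y ≤ 1) :
    1 - q + q * Real.exp y ≤ Real.exp (2 * q * y) := by
  have h1 := (abs_le.1 (Real.abs_exp_sub_one_sub_id_le (x := y) (by rwa [abs_of_nonneg hy0]))).2
  have h2 : Real.exp y ≤ 1 + 2 * y := by nlinarith
  have h3 := Real.add_one_le_exp (2 * q * y)
  nlinarith

/-- Bernoulli variables are removed one at a time. Averaging over one of them multiplies the
integrand by `1 - q + q exp (a + i v) ≤ exp (2 q (a + i v))`, which keeps its shape with `a`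
replaced by `a + 2 q v`; hence the induction is over all `a`. The size condition keeps `a + i v` in
`[0, 1]` throughout. The application has `a = 0`. -/
lemma binomMean_exp_le {q v : ℝ} (hq0 : 0 ≤ q) (hq1 : q ≤ 1) (hv : 0 ≤ v) (k : ℕ) :
    ∀ {a : ℝ}, 0 ≤ a → a + 2 * v * k ≤ 1 →
      binomMean q k (fun i => Real.exp ((i : ℝ) * (i - 1) / 2 * v + a * i))
        ≤ Real.exp (2 * q * a * k + 2 * q ^ 2 * v * k ^ 2) := by
  induction k with
  | zero => intro a _ _; simp [binomMean]
  | succ k ih =>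
    intro a ha hak
    push_cast at hak
    have hvk : 0 ≤ v * k := by positivity
    have hqv : q * v ≤ v := mul_le_of_le_one_left hv hq1
    have step : ∀ i ≤ k, (1 - q) * Real.exp ((i : ℝ) * (i - 1) / 2 * v + a * i)
        + q * Real.exp (((i + 1 : ℕ) : ℝ) * ((i + 1 : ℕ) - 1) / 2 * v + a * (i + 1 : ℕ))
        ≤ Real.exp (2 * q * a) *
          Real.exp ((i : ℝ) * (i - 1) / 2 * v + (a + 2 * q * v) * i) := fun i hi => by
      have hi' : (i : ℝ) ≤ k := by exact_mod_cast hi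
      have h1 := one_sub_add_mul_exp_le hq0 (y := a + i * v) (by positivity) (by nlinarith)
      have h2 : Real.exp (((i + 1 : ℕ) : ℝ) * ((i + 1 : ℕ) - 1) / 2 * v + a * (i + 1 : ℕ))
          = Real.exp (a + i * v) * Real.exp ((i : ℝ) * (i - 1) / 2 * v + a * i) := by
        rw [← Real.exp_add]; congr 1; push_cast; ring
      calc _ = (1 - q + q * Real.exp (a + i * v)) *
            Real.exp ((i : ℝ) * (i - 1) / 2 * v + a * i) := by rw [h2]; ring
        _ ≤ Real.exp (2 * q * (a + i * v)) *
            Real.exp ((i : ℝ) * (i - 1) / 2 * v + a * i) := by gcongr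
        _ = _ := by rw [← Real.exp_add, ← Real.exp_add]; congr 1; ring
    refine (binomMean_mono hq0 hq1 k step).trans ?_
    rw [binomMean_const_mul]
    refine (mul_le_mul_of_nonneg_left (ih (a := a + 2 * q * v) (by positivity) (by nlinarith))
      (Real.exp_pos _).le).trans ?_
    rw [← Real.exp_add]
    refine Real.exp_le_exp.2 ?_
    have : 0 ≤ q ^ 2 * v := by positivity
    push_cast
    nlinarith

/-- The density of `(1 - q) N(0, I) + q N(u, I)` with respect to `N(0, I)`. -/
noncomputable def mixDensity {d : ℕ} (q : ℝ) (u z : Vec d) : ℝ := 1 - q + q * shiftDensity u z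

section

variable {d : ℕ} {q : ℝ} (u : Vec d)

lemma mixDensity_pos (hq0 : 0 ≤ q) (hq1 : q ≤ 1) (z : Vec d) : 0 < mixDensity q u z := by
  unfold mixDensity
  have := shiftDensity_pos u z
  rcases hq1.lt_or_eq with h | rfl
  · have := sub_pos.2 h
    positivity
  · simpa

lemma measurable_mixDensity : Measurable (mixDensity q u) :=
  ((measurable_shiftDensity u).const_mul q).const_add (1 - q)

/-- Positive moments of the likelihood ratio of the subsampled Gaussian law. -/
lemma lintegral_mixDensity_pow_le (hq0 : 0 ≤ q) (hq1 : q ≤ 1) {v : ℝ} (hu : ‖u‖ ^ 2 ≤ v) (k : ℕ)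
    (h : q = 1 ∨ 2 * v * k ≤ 1) :
    ∫⁻ z, ENNReal.ofReal (mixDensity q u z ^ k) ∂(stdGaussian (Vec d))
      ≤ ENNReal.ofReal (Real.exp (2 * k ^ 2 * q ^ 2 * v)) := by
  have hint : ∀ i : ℕ, Integrable (fun z => shiftDensity u z ^ i) (stdGaussian (Vec d)) := fun i => by
    simpa using integrable_shiftDensity_rpow u (i : ℝ)
  have hval : ∀ i : ℕ, ∫ z, shiftDensity u z ^ i ∂(stdGaussian (Vec d))
      = Real.exp ((i : ℝ) * (i - 1) / 2 * ‖u‖ ^ 2) := fun i => by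
    simpa using integral_shiftDensity_rpow u (i : ℝ)
  have hB := integral_binomMean (stdGaussian (Vec d)) q k hint
  simp_rw [binomMean_pow, hval] at hB
  have hpos := fun z => (mixDensity_pos u hq0 hq1 z).le
  unfold mixDensity at hpos ⊢
  rw [← ofReal_integral_eq_lintegral_ofReal hB.1 (ae_of_all _ fun z => pow_nonneg (hpos z) k)]
  refine ENNReal.ofReal_le_ofReal (hB.2.trans_le ?_)
  have hv : 0 ≤ v := (sq_nonneg _).trans hu
  -- For `q = 1` the binomial law is concentrated at `k` and the moment is explicit, so no smallness
  -- of `v` is required.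
  rcases h with rfl | h
  · have h1 : ∀ (j : ℕ) (g : ℕ → ℝ), binomMean 1 j g = g j := by
      intro j
      induction j with
      | zero => intro g; rfl
      | succ j ih => intro g; rw [binomMean, ih]; simp
    rw [h1]
    refine Real.exp_le_exp.2 ?_
    have : (k : ℝ) * (k - 1) / 2 ≤ 2 * k ^ 2 := by nlinarith [sq_nonneg (k : ℝ), k.cast_nonneg (α := ℝ)]
    calc (k : ℝ) * (k - 1) / 2 * ‖u‖ ^ 2 ≤ 2 * k ^ 2 * ‖u‖ ^ 2 := by gcongr
      _ ≤ 2 * k ^ 2 * v := by gcongr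
      _ = _ := by ring
  · have h2 : 0 + 2 * ‖u‖ ^ 2 * k ≤ 1 := by
      rw [zero_add]; exact le_trans (by gcongr) h
    refine le_trans (le_of_eq ?_) ((binomMean_exp_le hq0 hq1 (sq_nonneg ‖u‖) k le_rfl h2).trans ?_)
    · simp
    · refine Real.exp_le_exp.2 ?_
      calc _ = 2 * k ^ 2 * q ^ 2 * ‖u‖ ^ 2 := by ring
        _ ≤ _ := by gcongr

/-- A second-order expansion at `w = 1`. Keeping the linear term exact matters: it has mean zero in
the application, up to a quadratic error. -/
lemma pow_le_quadratic {w W : ℝ} (hw : 0 ≤ w) (hW : 1 ≤ W) (hwW : w ≤ W) (k : ℕ) :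
    w ^ k ≤ 1 + k * (w - 1) + k ^ 2 * W ^ k * (w - 1) ^ 2 := by
  induction k with
  | zero => simp
  | succ k ih =>
    have hWk : 1 ≤ W ^ (k + 1) := one_le_pow₀ hW
    have h1 : (k : ℝ) ^ 2 * W ^ k * w ≤ k ^ 2 * W ^ (k + 1) := by
      rw [mul_assoc, pow_succ W]; gcongr
    have h2 : (k : ℝ) + k ^ 2 * W ^ k * w ≤ ((k + 1 : ℕ) : ℝ) ^ 2 * W ^ (k + 1) := by
      push_cast
      nlinarith [k.cast_nonneg (α := ℝ)]
    calc w ^ (k + 1) = w * w ^ k := pow_succ' _ _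
      _ ≤ w * (1 + k * (w - 1) + k ^ 2 * W ^ k * (w - 1) ^ 2) := by gcongr
      _ = 1 + (k + 1 : ℕ) * (w - 1) + (k + k ^ 2 * W ^ k * w) * (w - 1) ^ 2 := by push_cast; ring
      _ ≤ _ := by gcongr

/-- Apply `pow_le_quadratic` to `w = (1 + y)⁻¹` with `W = exp (2 q)`. The assumption `k q ≤ 1` gives
`W ^ k ≤ e² ≤ 8`, and `34 = 2 + 8 * 4` collects the quadratic errors. -/
lemma inv_one_add_pow_le {q y : ℝ} {k : ℕ} (hk : 2 ≤ k) (hq0 : 0 ≤ q) (hqk : k * q ≤ 1)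
    (hy : -q ≤ y) : ((1 + y)⁻¹) ^ k ≤ 1 - k * y + 34 * k ^ 2 * y ^ 2 := by
  have hk' : (2 : ℝ) ≤ k := by exact_mod_cast hk
  have hq : q ≤ 1 / 2 := by nlinarith
  have hy1 : 0 < 1 + y := by linarith
  have hyi : (1 + y)⁻¹ ≤ 2 := by
    rw [inv_le_comm₀ hy1 two_pos]; linarith
  have hw : (1 + y)⁻¹ - 1 = - y + y ^ 2 * (1 + y)⁻¹ := by field_simp; ring
  have hw1 : (1 + y)⁻¹ - 1 ≤ -y + 2 * y ^ 2 := by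
    rw [hw]; nlinarith [sq_nonneg y]
  have hw2 : ((1 + y)⁻¹ - 1) ^ 2 ≤ 4 * y ^ 2 := by
    have : (1 + y)⁻¹ - 1 = -(y * (1 + y)⁻¹) := by field_simp; ring
    rw [this, neg_sq, mul_pow]
    have h0 : 0 < (1 + y)⁻¹ := inv_pos.2 hy1
    nlinarith [sq_nonneg y]
  have hW : (1 + y)⁻¹ ≤ Real.exp (2 * q) := by
    rw [inv_le_comm₀ hy1 (Real.exp_pos _), ← Real.exp_neg]
    refine le_trans ?_ (by linarith : 1 - q ≤ 1 + y)
    rw [Real.exp_neg, inv_le_comm₀ (Real.exp_pos _) (by linarith)]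
    refine le_trans ?_ (Real.add_one_le_exp (2 * q))
    rw [inv_le_iff_one_le_mul₀ (by linarith)]
    nlinarith
  have hWk : Real.exp (2 * q) ^ k ≤ 8 := by
    rw [← Real.exp_nat_mul]
    calc Real.exp (k * (2 * q)) ≤ Real.exp 2 := Real.exp_le_exp.2 (by linarith)
      _ = Real.exp 1 ^ 2 := by rw [← Real.exp_nat_mul]; norm_num
      _ ≤ 2.7182818286 ^ 2 := by gcongr; exact Real.exp_one_lt_d9.le
      _ ≤ 8 := by norm_num
  refine (pow_le_quadratic (inv_nonneg.2 hy1.le) (Real.one_le_exp (by linarith)) hW k).trans ?_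
  calc 1 + (k : ℝ) * ((1 + y)⁻¹ - 1) + k ^ 2 * Real.exp (2 * q) ^ k * ((1 + y)⁻¹ - 1) ^ 2
      ≤ 1 + k * (-y + 2 * y ^ 2) + k ^ 2 * 8 * (4 * y ^ 2) := by gcongr
    _ ≤ _ := by nlinarith [mul_nonneg (mul_nonneg (sub_nonneg.2 hk') (by linarith : (0:ℝ) ≤ k)) (sq_nonneg y), sq_nonneg y]

/-- Negative moments of the likelihood ratio of the subsampled Gaussian law. -/
lemma lintegral_mixDensity_inv_pow_le (hq0 : 0 ≤ q) (hq1 : q ≤ 1) {v : ℝ} (hu : ‖u‖ ^ 2 ≤ v)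
    {k : ℕ} (hk : 2 ≤ k) (h : q = 1 ∨ v ≤ 1) :
    ∫⁻ z, ENNReal.ofReal ((mixDensity q u z)⁻¹ ^ k) ∂(stdGaussian (Vec d))
      ≤ ENNReal.ofReal (Real.exp (68 * k ^ 2 * q ^ 2 * v)) := by
  have hpos := fun z => mixDensity_pos u hq0 hq1 z
  have hk' : (2 : ℝ) ≤ k := by exact_mod_cast hk
  -- For `k q ≥ 1`, AM-GM bounds the mixture below by `shiftDensity ^ q`; the resulting exponent
  -- contains a term linear in `k q`, which `(k q)²` absorbs.
  rcases le_or_gt 1 (k * q) with hkq | hkq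
  · have h1 : ∀ z, (mixDensity q u z)⁻¹ ^ k ≤ shiftDensity u z ^ (-(k * q)) := fun z => by
      have h2 := Real.geom_mean_le_arith_mean2_weighted hq0 (sub_nonneg.2 hq1)
        (shiftDensity_pos u z).le zero_le_one (by ring)
      rw [Real.one_rpow, mul_one, mul_one, add_comm] at h2
      have h3 := Real.rpow_pos_of_pos (shiftDensity_pos u z) q
      calc (mixDensity q u z)⁻¹ ^ k ≤ (shiftDensity u z ^ q)⁻¹ ^ k := by
            have := hpos z
            gcongr
            exact h2
        _ = _ := by
            rw [inv_pow, ← Real.rpow_natCast, ← Real.rpow_mul (shiftDensity_pos u z).le,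
              Real.rpow_neg (shiftDensity_pos u z).le, mul_comm]
    refine (lintegral_mono fun z => ENNReal.ofReal_le_ofReal (h1 z)).trans ?_
    rw [lintegral_shiftDensity_rpow]
    refine ENNReal.ofReal_le_ofReal (Real.exp_le_exp.2 ?_)
    have h4 : -((k : ℝ) * q) * (-(k * q) - 1) / 2 ≤ 68 * (k * q) ^ 2 := by nlinarith
    calc _ ≤ 68 * (k * q) ^ 2 * ‖u‖ ^ 2 := by gcongr
      _ ≤ 68 * (k * q) ^ 2 * v := by gcongr
      _ = _ := by ring
  -- For `k q < 1` the density is `1 + y` with `y ≥ -q` and `E y = 0`. The linear term of the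
  -- expansion vanishes, leaving `E y² = q² (exp ‖u‖² - 1) ≤ 2 q² v`; thus `68 = 34 * 2`.
  · have hv : v ≤ 1 := h.resolve_left (by rintro rfl; linarith)
    set y : Vec d → ℝ := fun z => q * (shiftDensity u z - 1) with hy
    have hi1 := (integrable_shiftDensity u)
    have hi2 : Integrable (fun z => shiftDensity u z ^ 2) (stdGaussian (Vec d)) := by
      simpa using integrable_shiftDensity_rpow u 2
    have hv2 : ∫ z, shiftDensity u z ^ 2 ∂(stdGaussian (Vec d)) = Real.exp (‖u‖ ^ 2) := by
      have := integral_shiftDensity_rpow u 2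
      norm_num at this
      simpa using this
    have hiy1 : Integrable y (stdGaussian (Vec d)) := (hi1.sub (integrable_const 1)).const_mul q
    have hy2 : ∀ z, y z ^ 2 = q ^ 2 * (shiftDensity u z ^ 2 - 2 * shiftDensity u z + 1) :=
      fun z => by rw [hy]; ring
    have hiy2 : Integrable (fun z => y z ^ 2) (stdGaussian (Vec d)) := by
      simp_rw [hy2]
      exact ((hi2.sub (hi1.const_mul 2)).add (integrable_const 1)).const_mul _
    have hvy1 : ∫ z, y z ∂(stdGaussian (Vec d)) = 0 := by
      rw [hy, integral_const_mul, integral_sub hi1 (integrable_const 1), integral_shiftDensity]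
      simp
    have hi3 : Integrable (fun z => shiftDensity u z ^ 2 - 2 * shiftDensity u z)
        (stdGaussian (Vec d)) := hi2.sub (hi1.const_mul 2)
    have hvy2 : ∫ z, y z ^ 2 ∂(stdGaussian (Vec d)) = q ^ 2 * (Real.exp (‖u‖ ^ 2) - 1) := by
      simp_rw [hy2]
      rw [integral_const_mul, integral_add hi3 (integrable_const 1),
        integral_sub hi2 (hi1.const_mul 2), integral_const_mul, integral_shiftDensity, hv2]
      simp
      ring_nf
      simp
    have hle : ∀ z, (mixDensity q u z)⁻¹ ^ k ≤ 1 - k * y z + 34 * k ^ 2 * y z ^ 2 := fun z => by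
      have h1 : mixDensity q u z = 1 + y z := by rw [hy, mixDensity]; ring
      rw [h1]
      refine inv_one_add_pow_le hk hq0 hkq.le ?_
      have := shiftDensity_pos u z
      simp only [hy]
      nlinarith
    clear_value y
    have hI1 : Integrable (fun z => 1 - k * y z) (stdGaussian (Vec d)) :=
      (integrable_const (1 : ℝ)).sub (hiy1.const_mul (k : ℝ))
    have hI : Integrable (fun z => 1 - k * y z + 34 * k ^ 2 * y z ^ 2) (stdGaussian (Vec d)) :=
      hI1.add (hiy2.const_mul (34 * (k : ℝ) ^ 2))
    refine (lintegral_mono fun z => ENNReal.ofReal_le_ofReal (hle z)).trans ?_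
    rw [← ofReal_integral_eq_lintegral_ofReal hI (ae_of_all _ fun z =>
      (pow_nonneg (inv_nonneg.2 (hpos z).le) k).trans (hle z))]
    refine ENNReal.ofReal_le_ofReal ?_
    have hval : ∫ z, 1 - k * y z + 34 * k ^ 2 * y z ^ 2 ∂(stdGaussian (Vec d))
        = 1 + 34 * k ^ 2 * (q ^ 2 * (Real.exp (‖u‖ ^ 2) - 1)) := by
      rw [integral_add hI1 (hiy2.const_mul (34 * (k : ℝ) ^ 2)),
        integral_sub (integrable_const _) (hiy1.const_mul (k : ℝ)), integral_const_mul (k : ℝ) y,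
        integral_const_mul, hvy1, hvy2]
      simp
    rw [hval]
    have he : Real.exp (‖u‖ ^ 2) - 1 ≤ 2 * v := by
      have hv0 : 0 ≤ v := (sq_nonneg _).trans hu
      have h1 := (abs_le.1 (Real.abs_exp_sub_one_sub_id_le (x := v) (by rwa [abs_of_nonneg hv0]))).2
      have h2 := Real.exp_le_exp.2 hu
      nlinarith
    calc 1 + 34 * (k : ℝ) ^ 2 * (q ^ 2 * (Real.exp (‖u‖ ^ 2) - 1))
        ≤ 1 + 34 * (k : ℝ) ^ 2 * (q ^ 2 * (2 * v)) := by gcongr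
      _ = 68 * k ^ 2 * q ^ 2 * v + 1 := by ring
      _ ≤ _ := Real.add_one_le_exp _

end

/-! ### The subsampled Gaussian mechanism -/

section

variable {d : ℕ} {q : unitInterval}

lemma lintegral_bernoulliMeasure_bool (q : unitInterval) (g : Bool → ℝ≥0∞) :
    ∫⁻ B, g B ∂(bernoulliMeasure true false q)
      = ENNReal.ofReal q * g true + ENNReal.ofReal (1 - q) * g false := by
  rw [bernoulliMeasure_def, lintegral_add_measure]
  simp only [lintegral_smul_measure, lintegral_dirac, ENNReal.smul_def, smul_eq_mul]
  congr 2
  · rw [ENNReal.ofReal, Real.toNNReal_of_nonneg q.2.1]; rfl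
  · rw [ENNReal.ofReal, Real.toNNReal_of_nonneg (sub_nonneg.2 q.2.2)]; rfl

/-- The law of `a + B u + ξ` for `B` Bernoulli and `ξ` Gaussian. -/
noncomputable def subsampledLaw (q : unitInterval) (σ : ℝ) (a u : Vec d) : Measure (Vec d) :=
  ((bernoulliMeasure true false q).prod (noiseLaw d σ)).map
    fun y => a + (if y.1 then u else 0) + y.2

/-- The substitution `x = a + σ z` puts the laws for `u` and `u'` over one common reference, the
standard Gaussian. -/
lemma lintegral_subsampledLaw (q : unitInterval) {σ : ℝ} (hσ : 0 < σ) (a u : Vec d)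
    {g : Vec d → ℝ≥0∞} (hg : Measurable g) :
    ∫⁻ x, g x ∂(subsampledLaw q σ a u)
      = ∫⁻ z, ENNReal.ofReal (mixDensity q (σ⁻¹ • u) z) * g (a + σ • z) ∂(stdGaussian (Vec d)) := by
  have hm : Measurable fun y : Bool × Vec d => a + (if y.1 then u else 0) + y.2 := by
    refine Measurable.add (Measurable.const_add (Measurable.ite ?_ measurable_const
      measurable_const) _) measurable_snd
    exact measurable_fst (measurableSet_singleton true)
  have hg' : Measurable fun z => g (a + σ • z) := by fun_prop
  have hs := measurable_shiftDensity (σ⁻¹ • u)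
  rw [subsampledLaw, lintegral_map hg hm,
    lintegral_prod (fun y : Bool × Vec d => g (a + (if y.1 then u else 0) + y.2))
      (hg.comp hm).aemeasurable,
    lintegral_bernoulliMeasure_bool]
  have h1 : ∀ w : Vec d, ∫⁻ ξ, g (a + w + ξ) ∂(noiseLaw d σ)
      = ∫⁻ z, ENNReal.ofReal (shiftDensity (σ⁻¹ • w) z) * g (a + σ • z) ∂(stdGaussian (Vec d)) := by
    intro w
    rw [noiseLaw, lintegral_map (by fun_prop) (by fun_prop),
      ← lintegral_add_stdGaussian (σ⁻¹ • w) hg']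
    refine lintegral_congr fun z => ?_
    rw [smul_add, smul_inv_smul₀ hσ.ne', add_assoc, add_comm w]
  have h0 : ∀ z : Vec d, shiftDensity (σ⁻¹ • (0 : Vec d)) z = 1 := fun z => by simp [shiftDensity]
  simp only [if_true, Bool.false_eq_true, if_false, h1, h0, ENNReal.ofReal_one, one_mul]
  rw [← lintegral_const_mul _ (by fun_prop), ← lintegral_const_mul _ (by fun_prop),
    ← lintegral_add_left (by fun_prop)]
  refine lintegral_congr fun z => ?_
  rw [mixDensity, add_comm (1 - (q : ℝ)), ENNReal.ofReal_add
    (mul_nonneg q.2.1 (shiftDensity_pos _ _).le) (sub_nonneg.2 q.2.2),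
    ENNReal.ofReal_mul q.2.1]
  ring

/-- The privacy of the subsampled Gaussian mechanism, as a bound of a Rényi divergence. -/
lemma holderDominated_subsampledLaw {σ v : ℝ} (hσ : 0 < σ) (a : Vec d) {u u' : Vec d}
    (hu : ‖σ⁻¹ • u‖ ^ 2 ≤ v) (hu' : ‖σ⁻¹ • u'‖ ^ 2 ≤ v) {α : ℕ} (hα : 2 ≤ α)
    (h : (q : ℝ) = 1 ∨ 4 * v * α ≤ 1) :
    HolderDominated ((α : ℝ) / (α - 1)) (ENNReal.ofReal (Real.exp (140 * α * (q : ℝ) ^ 2 * v)))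
      (subsampledLaw q σ a u) (subsampledLaw q σ a u') := by
  intro g hg
  have hα' : (2 : ℝ) ≤ α := by exact_mod_cast hα
  have hv : 0 ≤ v := (sq_nonneg _).trans hu
  set p : ℝ := (α : ℝ) / (α - 1) with hp
  have hp1 : 1 < p := by rw [hp, one_lt_div (by linarith)]; linarith
  have hp0 : p ≠ 0 := by linarith
  have hconj : p.HolderConjugate α := (Real.HolderConjugate.conjExponent (by linarith)).symm
  have hαp : 1 / p * α = α - 1 := by rw [hp]; field_simp
  set N := stdGaussian (Vec d)
  set P : Vec d → ℝ := mixDensity q (σ⁻¹ • u) with hP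
  set Q : Vec d → ℝ := mixDensity q (σ⁻¹ • u') with hQ
  have hP0 : ∀ z, 0 < P z := mixDensity_pos _ q.2.1 q.2.2
  have hQ0 : ∀ z, 0 < Q z := mixDensity_pos _ q.2.1 q.2.2
  have hPm : Measurable P := measurable_mixDensity _
  have hQm : Measurable Q := measurable_mixDensity _
  rw [lintegral_subsampledLaw q hσ a u hg, lintegral_subsampledLaw q hσ a u' (hg.pow_const p)]
  set r : Vec d → ℝ≥0∞ := fun z => ENNReal.ofReal (Q z) with hr
  have hr0 : ∀ z, r z ≠ 0 := fun z => (ENNReal.ofReal_pos.2 (hQ0 z)).ne'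
  have hrt : ∀ z, r z ≠ ⊤ := fun z => ENNReal.ofReal_ne_top
  have hrm : Measurable r := hQm.ennreal_ofReal
  have hgm : Measurable fun z => g (a + σ • z) := by fun_prop
  have hF : Measurable fun z => r z ^ (1 / p) * g (a + σ • z) := by fun_prop
  have hH : Measurable fun z => ENNReal.ofReal (P z) * r z ^ (-(1 / p)) := by fun_prop
  -- The weight `r ^ (1 / p)` is chosen so that the first factor integrates `g ^ p` against the
  -- second law; as `α / p = α - 1`, the other becomes the Rényi integral of `P ^ α Q ^ (-(α - 1))`.
  have holder := ENNReal.lintegral_mul_le_Lp_mul_Lq N hconj hF.aemeasurable hH.aemeasurable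
  have e1 : ∀ z, (r z ^ (1 / p) * g (a + σ • z)) * (ENNReal.ofReal (P z) * r z ^ (-(1 / p)))
      = ENNReal.ofReal (P z) * g (a + σ • z) := fun z => by
    have : r z ^ (1 / p) * r z ^ (-(1 / p)) = 1 := by
      rw [← ENNReal.rpow_add _ _ (hr0 z) (hrt z), add_neg_cancel, ENNReal.rpow_zero]
    calc _ = (r z ^ (1 / p) * r z ^ (-(1 / p))) * (ENNReal.ofReal (P z) * g (a + σ • z)) := by ring
      _ = _ := by rw [this, one_mul]
  have e2 : ∀ z, (r z ^ (1 / p) * g (a + σ • z)) ^ p = r z * g (a + σ • z) ^ p := fun z => by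
    rw [ENNReal.mul_rpow_of_nonneg _ _ (by linarith), ← ENNReal.rpow_mul,
      one_div_mul_cancel hp0, ENNReal.rpow_one]
  have e3 : ∀ z, (ENNReal.ofReal (P z) * r z ^ (-(1 / p))) ^ (α : ℝ)
      = ENNReal.ofReal (P z ^ α) * ENNReal.ofReal ((Q z)⁻¹ ^ (α - 1)) := fun z => by
    rw [ENNReal.mul_rpow_of_nonneg _ _ (by linarith), ← ENNReal.rpow_mul, neg_mul, hαp,
      ENNReal.rpow_natCast, ENNReal.ofReal_pow (hP0 z).le, ENNReal.rpow_neg,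
      ENNReal.ofReal_pow (inv_nonneg.2 (hQ0 z).le), ENNReal.ofReal_inv_of_pos (hQ0 z)]
    congr 1
    have : (α : ℝ) - 1 = (α - 1 : ℕ) := by push_cast [Nat.cast_sub (by omega : 1 ≤ α)]; ring
    rw [this, ENNReal.rpow_natCast, ENNReal.inv_pow]
  simp only [Pi.mul_apply, e1, e2, e3] at holder
  refine holder.trans ?_
  rw [mul_comm]
  refine mul_le_mul_left ?_ _
  -- Cauchy–Schwarz separates `P` from `Q`, so that only moments of single mixtures are needed, of
  -- orders `2 α` and `-2 (α - 1)`.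
  have hCS := ENNReal.lintegral_mul_le_Lp_mul_Lq N Real.HolderConjugate.two_two
    (f := fun z => ENNReal.ofReal (P z ^ α)) (g := fun z => ENNReal.ofReal ((Q z)⁻¹ ^ (α - 1)))
    (by fun_prop) (by fun_prop)
  have e4 : ∀ z, ENNReal.ofReal (P z ^ α) ^ (2 : ℝ) = ENNReal.ofReal (P z ^ (2 * α)) := fun z => by
    rw [show (2 : ℝ) = (2 : ℕ) by norm_num, ENNReal.rpow_natCast,
      ← ENNReal.ofReal_pow (pow_nonneg (hP0 z).le _), ← pow_mul, mul_comm]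
  have e5 : ∀ z, ENNReal.ofReal ((Q z)⁻¹ ^ (α - 1)) ^ (2 : ℝ)
      = ENNReal.ofReal ((Q z)⁻¹ ^ (2 * (α - 1))) := fun z => by
    rw [show (2 : ℝ) = (2 : ℕ) by norm_num, ENNReal.rpow_natCast,
      ← ENNReal.ofReal_pow (pow_nonneg (inv_nonneg.2 (hQ0 z).le) _), ← pow_mul, mul_comm]
  simp only [Pi.mul_apply, e4, e5] at hCS
  have b1 := lintegral_mixDensity_pow_le (σ⁻¹ • u) q.2.1 q.2.2 hu (2 * α)
    (h.imp_right fun h => by push_cast; linarith)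
  have b2 := lintegral_mixDensity_inv_pow_le (σ⁻¹ • u') q.2.1 q.2.2 hu' (k := 2 * (α - 1))
    (by omega) (h.imp_right fun h => by nlinarith)
  have hα0 : (0 : ℝ) ≤ 1 / α := by positivity
  calc (∫⁻ z, ENNReal.ofReal (P z ^ α) * ENNReal.ofReal ((Q z)⁻¹ ^ (α - 1)) ∂N) ^ (1 / (α : ℝ))
      ≤ (ENNReal.ofReal (Real.exp (2 * (2 * α : ℕ) ^ 2 * (q : ℝ) ^ 2 * v)) ^ (1 / 2 : ℝ) *
          ENNReal.ofReal (Real.exp (68 * (2 * (α - 1) : ℕ) ^ 2 * (q : ℝ) ^ 2 * v)) ^ (1 / 2 : ℝ))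
          ^ (1 / (α : ℝ)) := by
        refine ENNReal.rpow_le_rpow (hCS.trans ?_) hα0
        gcongr
    _ = ENNReal.ofReal (Real.exp ((4 * α ^ 2 + 136 * (α - 1) ^ 2) * (q : ℝ) ^ 2 * v / α)) := by
        rw [ENNReal.ofReal_rpow_of_pos (Real.exp_pos _), ENNReal.ofReal_rpow_of_pos (Real.exp_pos _),
          ← Real.exp_mul, ← Real.exp_mul, ← ENNReal.ofReal_mul (Real.exp_pos _).le, ← Real.exp_add,
          ENNReal.ofReal_rpow_of_pos (Real.exp_pos _), ← Real.exp_mul]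
        congr 2
        push_cast [Nat.cast_sub (by omega : 1 ≤ α)]
        ring
    -- `140 = 4 + 136`, the halves of `2 * 2²` and `68 * 2²`; the root of order `α` leaves one
    -- factor `α`.
    _ ≤ _ := by
        refine ENNReal.ofReal_le_ofReal (Real.exp_le_exp.2 ?_)
        rw [div_le_iff₀ (by linarith)]
        have h1 : (4 * (α : ℝ) ^ 2 + 136 * (α - 1) ^ 2) ≤ 140 * α * α := by nlinarith
        have h2 : 0 ≤ (q : ℝ) ^ 2 * v := by positivity
        nlinarith

end

/-! ### Privacy of the transcript -/

section

variable {Z : Type*} {d n m : ℕ} {ω : ℝ} {f : Z → Vec d → ℝ}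

lemma perturbedGradKernel_apply (f : Z → Vec d → ℝ) (D : Fin m → Z) (b : ℕ) (σ : ℝ) (x : Vec d) :
    perturbedGradKernel f D b σ x = ((minibatchLaw b m).prod (noiseLaw d σ)).map
      fun p => stochGrad f D b x p.1 + p.2 := by
  rw [perturbedGradKernel, Kernel.map_apply _ (measurable_perturbedGrad f D b), Kernel.prod_apply,
    Kernel.id_apply, Kernel.const_apply, Measure.dirac_prod,
    Measure.map_map (measurable_perturbedGrad f D b) measurable_prodMk_left]
  rfl

/-- The inclusion probability of a sample. -/
noncomputable def inclProb (b m : ℕ) : unitInterval :=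
  Set.projIcc (0 : ℝ) 1 zero_le_one ((b : ℝ) / (m : ℝ))

lemma coe_inclProb {b m : ℕ} (hbm : b ≤ m) : (inclProb b m : ℝ) = (b : ℝ) / m := by
  have h : (b : ℝ) / m ≤ 1 := div_le_one_of_le₀ (by exact_mod_cast hbm) (Nat.cast_nonneg m)
  rw [inclProb, Set.projIcc_of_mem _ ⟨by positivity, h⟩]

lemma minibatchLaw_eq_pi (b m : ℕ) :
    minibatchLaw b m = Measure.pi fun _ => bernoulliMeasure true false (inclProb b m) := rfl

/-- Groups the inclusion bit of sample `j` with the noise and away from the other bits, so that one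
can condition on the latter. -/
lemma measurePreserving_insertNth {E F : Type*} [MeasurableSpace E] [MeasurableSpace F]
    (β : Measure E) [IsProbabilityMeasure β] (j : Fin (m + 1)) (ν : Measure F)
    [IsProbabilityMeasure ν] :
    MeasurePreserving (fun p : (Fin m → E) × E × F =>
        ((j.insertNth p.2.1 p.1 : Fin (m + 1) → E), p.2.2))
      ((Measure.pi fun _ => β).prod (β.prod ν)) ((Measure.pi fun _ => β).prod ν) := by
  have h1 : MeasurePreserving (fun p : E × (Fin m → E) => (j.insertNth p.1 p.2 : Fin (m + 1) → E))
      (β.prod (Measure.pi fun _ => β)) (Measure.pi fun _ => β) :=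
    (measurePreserving_piFinSuccAbove (fun _ : Fin (m + 1) => β) j).symm
  have h2 := h1.comp (Measure.measurePreserving_swap (μ := Measure.pi fun _ : Fin m => β) (ν := β))
  have h3 : MeasurePreserving (fun p : (Fin m → E) × E × F => ((p.1, p.2.1), p.2.2))
      ((Measure.pi fun _ => β).prod (β.prod ν)) (((Measure.pi fun _ => β).prod β).prod ν) :=
    (measurePreserving_prodAssoc (Measure.pi fun _ : Fin m => β) β ν).symm
  exact (h2.prod (MeasurePreserving.id ν)).comp h3

/-- The perturbed gradient, with the sample `j` singled out. -/
lemma perturbedGradKernel_apply_eq (f : Z → Vec d → ℝ) (D : Fin (m + 1) → Z) (b : ℕ) (σ : ℝ)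
    (x : Vec d) (j : Fin (m + 1)) :
    perturbedGradKernel f D b σ x =
      ((Measure.pi fun _ : Fin m => bernoulliMeasure true false (inclProb b (m + 1))).prod
        ((bernoulliMeasure true false (inclProb b (m + 1))).prod (noiseLaw d σ))).map
        fun p => stochGrad f (fun k => D (j.succAbove k)) b x p.1 +
          (if p.2.1 then (1 / (b : ℝ)) • gradient (f (D j)) x else 0) + p.2.2 := by
  have h3 := measurePreserving_insertNth (bernoulliMeasure true false (inclProb b (m + 1))) j
    (noiseLaw d σ)
  have hm : Measurable fun p : (Fin (m + 1) → Bool) × Vec d => stochGrad f D b x p.1 + p.2 :=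
    ((measurable_of_finite (stochGrad f D b x)).comp measurable_fst).add measurable_snd
  rw [perturbedGradKernel_apply, minibatchLaw_eq_pi, ← h3.map_eq, Measure.map_map hm h3.measurable]
  congr 1
  funext p
  obtain ⟨S, B, ξ⟩ := p
  simp only [Function.comp_apply, stochGrad, Fin.sum_univ_succAbove _ j, smul_add,
    Fin.insertNth_apply_same, Fin.insertNth_apply_succAbove, smul_ite, smul_zero]
  abel

/-- Given the other inclusion bits, both laws are a `subsampledLaw` with the same centre `a`, since
the datasets agree off `j`. The factors `q² = (b / m)²` and `1 / b²` combine to `1 / m²`, which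
removes `b`. -/
lemma holderDominated_perturbedGradKernel {G : ℝ} (hG : ∀ z, HasBoundedGradient G (f z))
    {D D' : Fin m → Z} (hD : Neighbors D D') {b : ℕ} (hb : 1 ≤ b) (hbm : b ≤ m) {σ : ℝ}
    (hσ : 0 < σ) {α : ℕ} (hα : 2 ≤ α) (h : b = m ∨ 4 * (G / (b * σ)) ^ 2 * α ≤ 1) (x : Vec d) :
    HolderDominated ((α : ℝ) / (α - 1)) (ENNReal.ofReal (Real.exp (140 * α * (G / (m * σ)) ^ 2)))
      (perturbedGradKernel f D b σ x) (perturbedGradKernel f D' b σ x) := by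
  obtain _ | m := m
  · omega
  obtain ⟨j, hj⟩ := hD
  have hb0 : (0 : ℝ) < b := by exact_mod_cast hb
  have hp1 : 1 < (α : ℝ) / (α - 1) := by
    have : (2 : ℝ) ≤ α := by exact_mod_cast hα
    rw [one_lt_div (by linarith)]; linarith
  have hq := coe_inclProb hbm
  rw [perturbedGradKernel_apply_eq f D b σ x j, perturbedGradKernel_apply_eq f D' b σ x j]
  have hrest : (fun k => D (j.succAbove k)) = fun k => D' (j.succAbove k) :=
    funext fun k => hj _ (j.succAbove_ne k)
  rw [hrest]
  have hm : ∀ w : Vec d, Measurable fun p : (Fin m → Bool) × (Bool × Vec d) =>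
      stochGrad f (fun k => D' (j.succAbove k)) b x p.1 + (if p.2.1 then w else 0) + p.2.2 := by
    intro w
    refine Measurable.add (Measurable.add ?_ (Measurable.ite ?_ measurable_const
      measurable_const)) (by fun_prop)
    · exact (measurable_of_finite (stochGrad f (fun k => D' (j.succAbove k)) b x)).comp
        measurable_fst
    · exact (measurable_fst.comp measurable_snd) (measurableSet_singleton true)
  have hbd : ∀ z, ‖σ⁻¹ • (1 / (b : ℝ)) • gradient (f z) x‖ ^ 2 ≤ (G / (b * σ)) ^ 2 := fun z => by
    rw [norm_smul, norm_smul, Real.norm_of_nonneg (by positivity),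
      Real.norm_of_nonneg (by positivity)]
    have := hG z x
    calc (σ⁻¹ * (1 / b * ‖gradient (f z) x‖)) ^ 2 ≤ (σ⁻¹ * (1 / b * G)) ^ 2 := by gcongr
      _ = _ := by congr 1; field_simp
  refine HolderDominated.map_prod hp1 (hm _) (hm _) fun S => ?_
  have key := holderDominated_subsampledLaw (q := inclProb b (m + 1)) hσ
    (stochGrad f (fun k => D' (j.succAbove k)) b x S) (hbd (D j)) (hbd (D' j)) hα
    (h.imp_left fun h => by rw [hq, h, div_self (by positivity)])
  have hC : 140 * α * ((inclProb b (m + 1) : ℝ)) ^ 2 * (G / (b * σ)) ^ 2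
      = 140 * α * (G / ((m + 1 : ℕ) * σ)) ^ 2 := by
    rw [hq]
    field_simp
  rw [hC] at key
  exact key

lemma roundKernel_apply (D : Fin n → Fin m → Z) (b : ℕ) (σ : ℝ) (C : Fin n → Compressor d ω)
    (x : Vec d) : roundKernel f D b σ C x = Measure.pi fun i => messageKernel f (D i) b σ (C i) x :=
  rfl

lemma measurable_snoc (t : ℕ) {E : Type*} [MeasurableSpace E] :
    Measurable fun p : (Fin t → E) × E => (Fin.snoc (α := fun _ => E) p.1 p.2 : Fin (t + 1) → E) := by
  refine measurable_pi_lambda _ fun i => ?_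
  refine Fin.lastCases ?_ (fun i => ?_) i
  · simpa using measurable_snd
  · simp only [Fin.snoc_castSucc]; fun_prop

instance isProbabilityMeasure_transcriptLaw (f : Z → Vec d → ℝ) (D : Fin n → Fin m → Z) (b : ℕ)
    (η : ℕ → ℝ) (σ : ℝ) (C : ℕ → Fin n → Compressor d ω) (x0 : Vec d) (T : ℕ) :
    IsProbabilityMeasure (transcriptLaw f D b η σ C x0 T) := by
  induction T with
  | zero => rw [transcriptLaw]; infer_instance
  | succ t ih =>
    rw [transcriptLaw]
    exact Measure.isProbabilityMeasure_map (measurable_snoc t).aemeasurable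

lemma holderDominated_roundKernel {p : ℝ} (hp : 1 < p) {c : ℝ≥0∞} {D D' : Fin n → Fin m → Z}
    {b : ℕ} {σ : ℝ} {i : Fin n} (hne : ∀ k, k ≠ i → D k = D' k)
    (h : ∀ x, HolderDominated p c (perturbedGradKernel f (D i) b σ x)
      (perturbedGradKernel f (D' i) b σ x)) (C : Fin n → Compressor d ω) (x : Vec d) :
    HolderDominated p c (roundKernel f D b σ C x) (roundKernel f D' b σ C x) := by
  rw [roundKernel_apply, roundKernel_apply]
  refine HolderDominated.pi hp i (fun k hk => by rw [hne k hk]) ?_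
  rw [messageKernel, messageKernel, Kernel.comp_apply, Kernel.comp_apply]
  exact (h x).bind hp _

/-- The one-round constant is uniform in the model `x`, so it survives the adaptive choice of `x`
from earlier messages and composes to its `T`-th power. -/
lemma holderDominated_transcriptLaw {p : ℝ} (hp : 1 < p) {c : ℝ≥0∞} {D D' : Fin n → Fin m → Z}
    {b : ℕ} {σ : ℝ} {i : Fin n} (hne : ∀ k, k ≠ i → D k = D' k)
    (h : ∀ x, HolderDominated p c (perturbedGradKernel f (D i) b σ x)
      (perturbedGradKernel f (D' i) b σ x)) (η : ℕ → ℝ) (C : ℕ → Fin n → Compressor d ω)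
    (x0 : Vec d) (T : ℕ) :
    HolderDominated p (c ^ T) (transcriptLaw f D b η σ C x0 T)
      (transcriptLaw f D' b η σ C x0 T) := by
  induction T with
  | zero => simpa [transcriptLaw] using HolderDominated.refl hp _
  | succ t ih =>
    rw [transcriptLaw, transcriptLaw, pow_succ]
    refine HolderDominated.map (ih.compProd hp fun s => ?_) (measurable_snoc t)
    rw [Kernel.comap_apply, Kernel.comap_apply]
    exact holderDominated_roundKernel hp hne h _ _

/-- Local differential privacy, for a noise level that suits the order `α` of the divergence. -/
lemma isLDP_transcriptLaw {G : ℝ} (hG : ∀ z, HasBoundedGradient G (f z)) {b : ℕ} (hb : 1 ≤ b)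
    (hbm : b ≤ m) {σ : ℝ} (hσ : 0 < σ) {α : ℕ} (hα : 2 ≤ α)
    (h : b = m ∨ 4 * (G / (b * σ)) ^ 2 * α ≤ 1) {ε δ : ℝ} (hδ : 0 < δ) (T : ℕ)
    (hT : 140 * α ^ 2 * (G / (m * σ)) ^ 2 * T ≤ ε * (α - 1) - Real.log (1 / δ))
    (η : ℕ → ℝ) (C : ℕ → Fin n → Compressor d ω) (x0 : Vec d) (D : Fin n → Fin m → Z) (i : Fin n) :
    IsLDP ε δ fun Di : Fin m → Z => transcriptLaw f (Function.update D i Di) b η σ C x0 T := by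
  intro Di Di' hD S hS
  have hα' : (2 : ℝ) ≤ α := by exact_mod_cast hα
  have hp1 : 1 < (α : ℝ) / (α - 1) := by rw [one_lt_div (by linarith)]; linarith
  have key := holderDominated_transcriptLaw hp1 (f := f) (D := Function.update D i Di)
    (D' := Function.update D i Di') (b := b) (σ := σ) (i := i)
    (fun k hk => by simp [hk]) (fun x => by
      simpa using holderDominated_perturbedGradKernel hG hD hb hbm hσ hα h x) η C x0 T
  rw [← ENNReal.ofReal_pow (Real.exp_pos _).le] at key
  refine key.measure_le hp1 hδ ?_ hS
  rw [← Real.exp_nat_mul, Real.rpow_def_of_pos hδ, ← Real.exp_add]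
  -- Here `1 / p = (α - 1) / α`; after multiplication by `α` the condition of `measure_le` is `hT`.
  refine Real.exp_le_exp.2 ?_
  rw [one_div, Real.log_inv] at hT
  have h1 : 1 / ((α : ℝ) / (α - 1)) = (α - 1) / α := by field_simp
  have h2 : ε * ((α - 1) / α) + Real.log δ * (1 - (α - 1) / α)
      = (ε * (α - 1) - -Real.log δ) / α := by field_simp; ring
  rw [h1, h2, le_div_iff₀ (by linarith)]
  refine le_trans (le_of_eq ?_) hT
  ring

end

/-! ### Means and variances of random vectors -/

/-- The random vector `X` is square integrable with mean `a` and variance at most `V`. -/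
structure HasMoments {Ω : Type*} [MeasurableSpace Ω] {d : ℕ} (μ : Measure Ω) (X : Ω → Vec d)
    (a : Vec d) (V : ℝ) : Prop where
  memLp : MemLp X 2 μ
  mean : ∫ x, X x ∂μ = a
  var : ∫ x, ‖X x - a‖ ^ 2 ∂μ ≤ V

namespace HasMoments

variable {Ω Ω' : Type*} [MeasurableSpace Ω] [MeasurableSpace Ω'] {d : ℕ} {μ : Measure Ω}
  {X : Ω → Vec d} {a : Vec d} {V : ℝ}

lemma nonneg (h : HasMoments μ X a V) : 0 ≤ V :=
  (integral_nonneg fun _ => sq_nonneg _).trans h.var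

lemma const_smul (h : HasMoments μ X a V) (c : ℝ) :
    HasMoments μ (fun x => c • X x) (c • a) (c ^ 2 * V) := by
  refine ⟨h.memLp.const_smul c, by rw [integral_smul, h.mean], ?_⟩
  have h1 : ∀ x, ‖c • X x - c • a‖ ^ 2 = c ^ 2 * ‖X x - a‖ ^ 2 := fun x => by
    rw [← smul_sub, norm_smul, mul_pow, Real.norm_eq_abs, sq_abs]
  simp_rw [h1]
  rw [integral_const_mul]
  exact mul_le_mul_of_nonneg_left h.var (sq_nonneg c)

lemma mono {V' : ℝ} (h : HasMoments μ X a V) (hV : V ≤ V') : HasMoments μ X a V' :=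
  ⟨h.memLp, h.mean, h.var.trans hV⟩

section

variable [IsProbabilityMeasure μ]

lemma integrable (h : HasMoments μ X a V) : Integrable X μ := h.memLp.integrable (by norm_num)

lemma integrable_sq_sub (h : HasMoments μ X a V) (c : Vec d) :
    Integrable (fun x => ‖X x - c‖ ^ 2) μ :=
  (h.memLp.sub (memLp_const c)).integrable_norm_pow two_ne_zero

lemma integral_sq_sub (h : HasMoments μ X a V) (c : Vec d) :
    ∫ x, ‖X x - c‖ ^ 2 ∂μ = ∫ x, ‖X x - a‖ ^ 2 ∂μ + ‖a - c‖ ^ 2 := by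
  have hi : Integrable (fun x => X x - a) μ := h.integrable.sub (integrable_const a)
  have hi2 : Integrable (fun x => 2 * inner ℝ (a - c) (X x - a)) μ :=
    (hi.const_inner (a - c)).const_mul 2
  have hi3 : Integrable (fun x => 2 * inner ℝ (a - c) (X x - a) + ‖a - c‖ ^ 2) μ :=
    hi2.add (integrable_const _)
  have h1 : ∀ x, ‖X x - c‖ ^ 2
      = ‖X x - a‖ ^ 2 + (2 * inner ℝ (a - c) (X x - a) + ‖a - c‖ ^ 2) := fun x => by
    rw [← sub_add_sub_cancel (X x) a c, norm_add_sq_real, real_inner_comm]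
    ring
  simp_rw [h1]
  rw [integral_add (h.integrable_sq_sub a) hi3,
    integral_add hi2 (integrable_const _), integral_const_mul, integral_inner hi,
    integral_sub h.integrable (integrable_const a), h.mean]
  simp

lemma integral_sq_sub_le (h : HasMoments μ X a V) (c : Vec d) :
    ∫ x, ‖X x - c‖ ^ 2 ∂μ ≤ V + ‖a - c‖ ^ 2 := by
  rw [h.integral_sq_sub c]
  gcongr
  exact h.var

lemma integral_sq_le (h : HasMoments μ X a V) : ∫ x, ‖X x‖ ^ 2 ∂μ ≤ V + ‖a‖ ^ 2 := by
  simpa using h.integral_sq_sub_le 0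

/-- The second moment supplies square integrability. The mean is asked for only under integrability
because Fubini needs that to compute it. -/
lemma of_lintegral (hX : AEStronglyMeasurable X μ) (hV : 0 ≤ V)
    (h : ∫⁻ x, ENNReal.ofReal (‖X x - a‖ ^ 2) ∂μ ≤ ENNReal.ofReal V)
    (hmean : Integrable X μ → ∫ x, X x ∂μ = a) : HasMoments μ X a V := by
  have hm : AEStronglyMeasurable (fun x => X x - a) μ := hX.sub aestronglyMeasurable_const
  have hi : Integrable (fun x => ‖X x - a‖ ^ 2) μ := by
    refine ⟨by fun_prop, ?_⟩
    rw [hasFiniteIntegral_iff_ofReal (ae_of_all _ fun x => sq_nonneg _)]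
    exact h.trans_lt ENNReal.ofReal_lt_top
  have hL : MemLp X 2 μ := by
    have := ((memLp_two_iff_integrable_sq_norm hm).2 hi).add (memLp_const a)
    simpa [Pi.add_def] using this
  refine ⟨hL, hmean (hL.integrable (by norm_num)), ?_⟩
  rw [← ENNReal.ofReal_le_ofReal_iff hV,
    ofReal_integral_eq_lintegral_ofReal hi (ae_of_all _ fun x => sq_nonneg _)]
  exact h

/-- The law of total variance. -/
lemma compProd (h : HasMoments μ X a V) {κ : Kernel Ω Ω'} [IsMarkovKernel κ]
    {Y : Ω × Ω' → Vec d} (hY : Measurable Y) {W : Ω → ℝ} (hW : Integrable W μ) {U : ℝ}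
    (hWU : ∫ x, W x ∂μ ≤ U) (hκ : ∀ x, HasMoments (κ x) (fun y => Y (x, y)) (X x) (W x)) :
    HasMoments (μ ⊗ₘ κ) Y a (V + U) := by
  have hW0 : ∀ x, 0 ≤ W x := fun x => (hκ x).nonneg
  have hU : 0 ≤ U := (integral_nonneg hW0).trans hWU
  have hWi : Integrable (fun x => W x + ‖X x - a‖ ^ 2) μ := hW.add (h.integrable_sq_sub a)
  refine of_lintegral hY.aestronglyMeasurable (add_nonneg h.nonneg hU) ?_ fun hi => ?_
  · rw [Measure.lintegral_compProd (by fun_prop)]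
    calc ∫⁻ x, ∫⁻ y, ENNReal.ofReal (‖Y (x, y) - a‖ ^ 2) ∂κ x ∂μ
        ≤ ∫⁻ x, ENNReal.ofReal (W x + ‖X x - a‖ ^ 2) ∂μ := lintegral_mono fun x => by
          rw [← ofReal_integral_eq_lintegral_ofReal ((hκ x).integrable_sq_sub a)
            (ae_of_all _ fun x => sq_nonneg _)]
          exact ENNReal.ofReal_le_ofReal ((hκ x).integral_sq_sub_le a)
      _ = ENNReal.ofReal (∫ x, W x + ‖X x - a‖ ^ 2 ∂μ) := by
          rw [ofReal_integral_eq_lintegral_ofReal hWi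
            (ae_of_all _ fun x => add_nonneg (hW0 x) (sq_nonneg _))]
      _ ≤ _ := by
          refine ENNReal.ofReal_le_ofReal ?_
          rw [integral_add hW (h.integrable_sq_sub a)]
          linarith [h.var]
  · rw [Measure.integral_compProd hi, ← h.mean]
    exact integral_congr_ae (ae_of_all _ fun x => (hκ x).mean)

lemma prod_add (h : HasMoments μ X a V) {ν : Measure Ω'} [IsProbabilityMeasure ν]
    {Y : Ω' → Vec d} {b : Vec d} {U : ℝ} (h' : HasMoments ν Y b U) (hX : Measurable X)
    (hY : Measurable Y) : HasMoments (μ.prod ν) (fun p => X p.1 + Y p.2) (a + b) (V + U) := by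
  have h1 : HasMoments μ (fun x => X x + b) (a + b) V := by
    refine ⟨h.memLp.add (memLp_const b), ?_, ?_⟩
    · rw [integral_add h.integrable (integrable_const b), h.mean]; simp
    · simpa using h.var
  have hm : Measurable fun p : Ω × Ω' => X p.1 + Y p.2 :=
    (hX.comp measurable_fst).add (hY.comp measurable_snd)
  have h2 : ∀ x, HasMoments (Kernel.const Ω ν x) (fun y => X x + Y y) (X x + b) U := fun x => by
    rw [Kernel.const_apply]
    refine ⟨(memLp_const (X x)).add h'.memLp, ?_, ?_⟩
    · rw [integral_add (integrable_const _) h'.integrable, h'.mean]; simp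
    · simpa using h'.var
  have h3 := h1.compProd (κ := Kernel.const Ω ν) hm (integrable_const U) (U := U) (by simp) h2
  rwa [Measure.compProd_const] at h3

end

lemma map_iff {φ : Ω' → Ω} {ν : Measure Ω'} (hφ : Measurable φ) (hX : Measurable X) :
    HasMoments (ν.map φ) X a V ↔ HasMoments ν (fun y => X (φ y)) a V := by
  constructor <;> rintro ⟨h1, h2, h3⟩ <;> refine ⟨?_, ?_, ?_⟩
  · exact (memLp_map_measure_iff hX.aestronglyMeasurable hφ.aemeasurable).1 h1
  · rwa [integral_map hφ.aemeasurable hX.aestronglyMeasurable] at h2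
  · rwa [integral_map hφ.aemeasurable (by fun_prop)] at h3
  · exact (memLp_map_measure_iff hX.aestronglyMeasurable hφ.aemeasurable).2 h1
  · rwa [integral_map hφ.aemeasurable hX.aestronglyMeasurable]
  · rwa [integral_map hφ.aemeasurable (by fun_prop)]

lemma bind [IsProbabilityMeasure μ] (h : HasMoments μ X a V) {κ : Kernel Ω (Vec d)}
    [IsMarkovKernel κ] {W : Ω → ℝ} (hW : Integrable W μ) {U : ℝ} (hWU : ∫ x, W x ∂μ ≤ U)
    (hκ : ∀ x, HasMoments (κ x) (fun y => y) (X x) (W x)) :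
    HasMoments (κ ∘ₘ μ) (fun y => y) a (V + U) := by
  rw [← Measure.snd_compProd, Measure.snd, map_iff measurable_snd measurable_id']
  exact h.compProd measurable_snd hW hWU hκ

lemma pi_sum {n : ℕ} {μ : Fin n → Measure Ω} [∀ i, IsProbabilityMeasure (μ i)]
    {X : Fin n → Ω → Vec d} {a : Fin n → Vec d} {V : Fin n → ℝ} (hX : ∀ i, Measurable (X i))
    (h : ∀ i, HasMoments (μ i) (X i) (a i) (V i)) :
    HasMoments (Measure.pi μ) (fun y => ∑ i, X i (y i)) (∑ i, a i) (∑ i, V i) := by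
  induction n with
  | zero => exact ⟨by simp, by simp, by simp⟩
  | succ n ih =>
    have h1 : MeasurePreserving
        (fun p : Ω × (Fin n → Ω) => (Fin.insertNth 0 p.1 p.2 : Fin (n + 1) → Ω))
        ((μ 0).prod (Measure.pi fun i => μ (Fin.succAbove 0 i))) (Measure.pi μ) :=
      (measurePreserving_piFinSuccAbove μ 0).symm
    have hm : Measurable fun y : Fin (n + 1) → Ω => ∑ i, X i (y i) :=
      Finset.measurable_fun_sum _ fun i _ => (hX i).comp (measurable_pi_apply i)
    rw [← h1.map_eq, map_iff h1.measurable hm]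
    simp only [Fin.sum_univ_succAbove _ 0, Fin.insertNth_apply_same, Fin.insertNth_apply_succAbove]
    exact (h 0).prod_add (ih (fun i => hX (Fin.succAbove 0 i)) fun i => h (Fin.succAbove 0 i)) (hX 0)
      (Finset.measurable_fun_sum _ fun i _ =>
        (hX (Fin.succAbove 0 i)).comp (measurable_pi_apply i))

end HasMoments

/-! ### Moments of the messages -/

section

variable {Z : Type*} {d n m : ℕ} {ω : ℝ} {f : Z → Vec d → ℝ}

lemma hasMoments_stdGaussian (d : ℕ) :
    HasMoments (stdGaussian (Vec d)) (fun z => z) 0 d := by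
  have hL : MemLp (fun z : Vec d => z) 2 (stdGaussian (Vec d)) := IsGaussian.memLp_two_id
  refine ⟨hL, integral_id_stdGaussian, le_of_eq ?_⟩
  have h1 : ∀ i : Fin d, ∫ z : Vec d, z i ^ 2 ∂(stdGaussian (Vec d)) = 1 := fun i => by
    have h2 := variance_dual_stdGaussian (E := Vec d) (EuclideanSpace.proj i)
    have h3 : ∫ z : Vec d, (EuclideanSpace.proj i : StrongDual ℝ (Vec d)) z ∂(stdGaussian (Vec d))
      = 0 := integral_strongDual_stdGaussian _
    rw [variance_of_integral_eq_zero (by fun_prop) h3] at h2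
    refine Eq.trans ?_ (h2.trans ?_)
    · rfl
    · have : (EuclideanSpace.proj i : StrongDual ℝ (Vec d))
          = innerSL ℝ (EuclideanSpace.single i (1 : ℝ)) := by
        ext z; simp [EuclideanSpace.inner_single_left]
      rw [this, innerSL_apply_norm]
      simp
  have hi : ∀ i : Fin d, Integrable (fun z : Vec d => z i ^ 2) (stdGaussian (Vec d)) := fun i =>
    (hL.continuousLinearMap_comp (EuclideanSpace.proj i : Vec d →L[ℝ] ℝ)).integrable_sq
  simp_rw [sub_zero, EuclideanSpace.real_norm_sq_eq]
  rw [integral_finsetSum _ fun i _ => hi i]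
  simp [h1]

lemma hasMoments_noiseLaw (d : ℕ) (σ : ℝ) :
    HasMoments (noiseLaw d σ) (fun z => z) 0 (d * σ ^ 2) := by
  rw [noiseLaw, HasMoments.map_iff (by fun_prop) measurable_id']
  have := (hasMoments_stdGaussian d).const_smul σ
  rwa [smul_zero, mul_comm] at this

/-- The gradient of a local objective. -/
noncomputable def localGrad (f : Z → Vec d → ℝ) (D : Fin m → Z) (x : Vec d) : Vec d :=
  (1 / (m : ℝ)) • ∑ j, gradient (f (D j)) x

lemma norm_average_le {G : ℝ} (hm : 1 ≤ m) {g : Fin m → Vec d} (hg : ∀ j, ‖g j‖ ≤ G) :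
    ‖(1 / (m : ℝ)) • ∑ j, g j‖ ≤ G := by
  have hm0 : (0 : ℝ) < m := by exact_mod_cast hm
  rw [norm_smul, Real.norm_of_nonneg (by positivity), one_div, inv_mul_le_iff₀ hm0]
  refine (norm_sum_le _ _).trans ((Finset.sum_le_sum fun j _ => hg j).trans ?_)
  simp

lemma hasMoments_bernoulli (q : unitInterval) (w : Vec d) :
    HasMoments (bernoulliMeasure true false q) (fun B => if B then w else 0) ((q : ℝ) • w)
      (q * ‖w‖ ^ 2) := by
  have hL : MemLp (fun B : Bool => if B then w else 0) 2 (bernoulliMeasure true false q) :=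
    MemLp.of_bound (measurable_of_finite _).aestronglyMeasurable ‖w‖
      (ae_of_all _ fun B => by cases B <;> simp)
  have hmean : ∫ B, (if B then w else 0) ∂(bernoulliMeasure true false q) = (q : ℝ) • w := by
    rw [integral_bernoulliMeasure]; simp
  have h0 : HasMoments (bernoulliMeasure true false q) (fun B => if B then w else 0)
    ((q : ℝ) • w) _ := ⟨hL, hmean, le_rfl⟩
  refine ⟨hL, hmean, ?_⟩
  have h1 := h0.integral_sq_sub 0
  rw [integral_bernoulliMeasure] at h1
  simp only [if_true, sub_zero, Bool.false_eq_true, if_false, norm_zero, smul_eq_mul] at h1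
  have := sq_nonneg ‖(q : ℝ) • w‖
  simp at h1
  linarith

/-- Independence gives variance at most `G² / b`. The cruder `G²` is enough, as the privacy noise
will dominate it for every `b`. -/
lemma hasMoments_stochGrad {G : ℝ} (hG : ∀ z, HasBoundedGradient G (f z)) (D : Fin m → Z) {b : ℕ}
    (hb : 1 ≤ b) (hbm : b ≤ m) (x : Vec d) :
    HasMoments (minibatchLaw b m) (stochGrad f D b x) (localGrad f D x) (G ^ 2) := by
  have hb0 : (1 : ℝ) ≤ b := by exact_mod_cast hb
  have hm0 : (0 : ℝ) < m := by exact_mod_cast (hb.trans hbm)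
  have h := (HasMoments.pi_sum (fun j => measurable_of_finite _)
    fun j : Fin m => hasMoments_bernoulli (inclProb b m) (gradient (f (D j)) x)).const_smul
      (1 / (b : ℝ))
  rw [← minibatchLaw_eq_pi, coe_inclProb hbm] at h
  have hmean : (1 / (b : ℝ)) • ∑ j, ((b : ℝ) / m) • gradient (f (D j)) x = localGrad f D x := by
    rw [← Finset.smul_sum, smul_smul, localGrad]
    congr 1
    field_simp
  rw [hmean] at h
  refine h.mono ?_
  calc (1 / (b : ℝ)) ^ 2 * ∑ j, (b : ℝ) / m * ‖gradient (f (D j)) x‖ ^ 2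
      ≤ (1 / (b : ℝ)) ^ 2 * ∑ _j : Fin m, (b : ℝ) / m * G ^ 2 := by
        gcongr with j; exact hG _ _
    _ = G ^ 2 / b := by simp; field_simp
    _ ≤ G ^ 2 := div_le_self (sq_nonneg G) hb0

lemma hasMoments_perturbedGradKernel {G : ℝ} (hG : ∀ z, HasBoundedGradient G (f z))
    (D : Fin m → Z) {b : ℕ} (hb : 1 ≤ b) (hbm : b ≤ m) (σ : ℝ) (x : Vec d) :
    HasMoments (perturbedGradKernel f D b σ x) (fun y => y) (localGrad f D x)
      (G ^ 2 + d * σ ^ 2) := by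
  have hs : Measurable (stochGrad f D b x) := measurable_of_finite _
  rw [perturbedGradKernel_apply, HasMoments.map_iff (by fun_prop) measurable_id']
  simpa using (hasMoments_stochGrad hG D hb hbm x).prod_add (hasMoments_noiseLaw d σ) hs
    measurable_id'

lemma Compressor.hasMoments (C : Compressor d ω) (x : Vec d) :
    HasMoments (C.kernel x) (fun y => y) x (ω * ‖x‖ ^ 2) := by
  refine ⟨?_, C.mean_eq x, C.variance_le x⟩
  have := ((memLp_two_iff_integrable_sq_norm (by fun_prop)).2 (C.integrable_sq x)).add
    (memLp_const x)
  simpa [Pi.add_def] using this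

/-- Compression adds `ω E‖g‖²`, and `E‖g‖² ≤ 2 G² + d σ²`: one `G²` from the sampling variance, one
from the squared mean. -/
lemma hasMoments_messageKernel {G : ℝ} (hG : ∀ z, HasBoundedGradient G (f z))
    (D : Fin m → Z) {b : ℕ} (hb : 1 ≤ b) (hbm : b ≤ m) (σ : ℝ) (hω : 0 ≤ ω) (C : Compressor d ω)
    (x : Vec d) :
    HasMoments (messageKernel f D b σ C x) (fun y => y) (localGrad f D x)
      ((1 + ω) * (2 * G ^ 2 + d * σ ^ 2)) := by
  have h := hasMoments_perturbedGradKernel hG D hb hbm σ x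
  have hi : Integrable (fun y : Vec d => ω * ‖y‖ ^ 2) (perturbedGradKernel f D b σ x) := by
    simpa using (h.integrable_sq_sub 0).const_mul ω
  have hg : ‖localGrad f D x‖ ≤ G := norm_average_le (hb.trans hbm) fun j => hG _ _
  have hle : ∫ y : Vec d, ω * ‖y‖ ^ 2 ∂(perturbedGradKernel f D b σ x)
      ≤ ω * (2 * G ^ 2 + d * σ ^ 2) := by
    rw [integral_const_mul]
    refine mul_le_mul_of_nonneg_left (h.integral_sq_le.trans ?_) hω
    have : ‖localGrad f D x‖ ^ 2 ≤ G ^ 2 := by gcongr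
    linarith
  rw [messageKernel, Kernel.comp_apply]
  refine (h.bind hi hle C.hasMoments).mono ?_
  nlinarith [sq_nonneg G]

lemma hasMoments_roundKernel {G : ℝ} (hG : ∀ z, HasBoundedGradient G (f z))
    (D : Fin n → Fin m → Z) (hn : 1 ≤ n) {b : ℕ} (hb : 1 ≤ b) (hbm : b ≤ m) (σ : ℝ) (hω : 0 ≤ ω)
    (C : Fin n → Compressor d ω) (x : Vec d) :
    HasMoments (roundKernel f D b σ C x) (fun h => (1 / (n : ℝ)) • ∑ i, h i)
      ((1 / (n : ℝ)) • ∑ i, localGrad f (D i) x)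
      ((1 + ω) * (2 * G ^ 2 + d * σ ^ 2) / n) := by
  have hn0 : (0 : ℝ) < n := by exact_mod_cast hn
  have h := (HasMoments.pi_sum (fun _ => measurable_id') fun i =>
    hasMoments_messageKernel hG (D i) hb hbm σ hω (C i) x).const_smul (1 / (n : ℝ))
  rw [roundKernel_apply]
  refine h.mono (le_of_eq ?_)
  simp
  field_simp

end

/-! ### Smooth functions -/

section

variable {Z : Type*} {d n m : ℕ} {L G : ℝ} {f : Z → Vec d → ℝ}

lemma hasGradientAt_average {k : ℕ} {g : Fin k → Vec d → ℝ} {g' : Fin k → Vec d} {x : Vec d}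
    (h : ∀ j, HasGradientAt (g j) (g' j) x) :
    HasGradientAt (fun y => (1 / (k : ℝ)) * ∑ j, g j y) ((1 / (k : ℝ)) • ∑ j, g' j) x := by
  rw [hasGradientAt_iff_hasFDerivAt, map_smul, map_sum]
  exact (HasFDerivAt.fun_sum fun j _ => (h j).hasFDerivAt).const_mul _

lemma hasGradientAt_globalLoss (hf : ∀ z, IsSmooth L (f z)) (D : Fin n → Fin m → Z) (x : Vec d) :
    HasGradientAt (globalLoss f D) ((1 / (n : ℝ)) • ∑ i, localGrad f (D i) x) x :=
  hasGradientAt_average fun _ => hasGradientAt_average fun _ => ((hf _).1 x).hasGradientAt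

lemma isSmooth_globalLoss (hf : ∀ z, IsSmooth L (f z)) (D : Fin n → Fin m → Z) (hn : 1 ≤ n)
    (hm : 1 ≤ m) : IsSmooth L (globalLoss f D) := by
  refine ⟨fun x => (hasGradientAt_globalLoss hf D x).differentiableAt, fun x y => ?_⟩
  rw [(hasGradientAt_globalLoss hf D x).gradient, (hasGradientAt_globalLoss hf D y).gradient,
    ← smul_sub, ← Finset.sum_sub_distrib]
  refine norm_average_le hn fun i => ?_
  rw [localGrad, localGrad, ← smul_sub, ← Finset.sum_sub_distrib]
  exact norm_average_le hm fun j => (hf _).2 x y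

lemma norm_gradient_globalLoss_le (hf : ∀ z, IsSmooth L (f z))
    (hG : ∀ z, HasBoundedGradient G (f z)) (D : Fin n → Fin m → Z) (hn : 1 ≤ n) (hm : 1 ≤ m)
    (x : Vec d) : ‖gradient (globalLoss f D) x‖ ≤ G := by
  rw [(hasGradientAt_globalLoss hf D x).gradient]
  exact norm_average_le hn fun i => norm_average_le hm fun j => hG _ _

/-- The descent lemma. -/
lemma IsSmooth.le_quadratic {F : Vec d → ℝ} (hF : IsSmooth L F) (x w : Vec d) :
    F (x + w) ≤ F x + inner ℝ (gradient F x) w + L / 2 * ‖w‖ ^ 2 := by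
  have hd : ∀ t : ℝ, HasDerivAt
      (fun t : ℝ => F (x + t • w) - (t * inner ℝ (gradient F x) w + L / 2 * ‖w‖ ^ 2 * t ^ 2))
      (inner ℝ (gradient F (x + t • w)) w
        - (inner ℝ (gradient F x) w + L / 2 * ‖w‖ ^ 2 * (2 * t))) t := fun t => by
    have h1 : HasDerivAt (fun t : ℝ => x + t • w) w t := by
      simpa using ((hasDerivAt_id t).smul_const w).const_add x
    have h2 := (hF.1 (x + t • w)).hasFDerivAt.comp_hasDerivAt t h1
    rw [← inner_gradient_left] at h2
    refine h2.sub ?_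
    have h3 := ((hasDerivAt_id t).mul_const (inner ℝ (gradient F x) w)).fun_add
      ((hasDerivAt_pow 2 t).const_mul (L / 2 * ‖w‖ ^ 2))
    simpa using h3
  -- The difference between `F` along the segment and its quadratic majorant is nonincreasing on
  -- `[0, 1]`; compare the endpoints.
  have hanti := antitoneOn_of_deriv_nonpos (convex_Icc (0 : ℝ) 1)
    (fun t _ => (hd t).continuousAt.continuousWithinAt)
    (fun t _ => (hd t).differentiableAt.differentiableWithinAt) fun t ht => by
      rw [interior_Icc] at ht
      rw [(hd t).deriv]
      have h1 := real_inner_le_norm (gradient F (x + t • w) - gradient F x) w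
      have h2 := hF.2 (x + t • w) x
      rw [add_sub_cancel_left, norm_smul, Real.norm_of_nonneg ht.1.le] at h2
      have h3 := mul_le_mul_of_nonneg_right h2 (norm_nonneg w)
      rw [inner_sub_left] at h1
      linarith
  have := hanti (Set.left_mem_Icc.2 zero_le_one) (Set.right_mem_Icc.2 zero_le_one) zero_le_one
  simp [-inner_gradient_left] at this
  linarith

/-- A function with constant gradient that is bounded below has zero gradient. -/
lemma IsSmooth.gradient_eq_zero {F : Vec d → ℝ} (hF : IsSmooth 0 F)
    (hb : BddBelow (Set.range F)) (x : Vec d) : gradient F x = 0 := by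
  obtain ⟨B, hB⟩ := hb
  by_contra hne
  have hpos : 0 < ‖gradient F x‖ ^ 2 := by positivity
  -- A step of this length along the negative gradient lowers `F` by `F x - B + 1`, to below its
  -- lower bound `B`.
  set s : ℝ := (F x - B + 1) / ‖gradient F x‖ ^ 2 with hs
  have h1 := hF.le_quadratic x (-s • gradient F x)
  have h2 := hB ⟨x + -s • gradient F x, rfl⟩
  rw [inner_smul_right, real_inner_self_eq_norm_sq] at h1
  have h3 : s * ‖gradient F x‖ ^ 2 = F x - B + 1 := div_mul_cancel₀ _ hpos.ne'
  rw [zero_div, zero_mul, neg_mul, h3] at h1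
  linarith

/-- The expected decrease of a smooth function in one step of stochastic gradient descent. -/
lemma IsSmooth.descent {Ω : Type*} [MeasurableSpace Ω] {μ : Measure Ω} [IsProbabilityMeasure μ]
    {F : Vec d → ℝ} (hF : IsSmooth L F) {B : ℝ} (hB : ∀ y, B ≤ F y) {η V : ℝ} (hη : 0 ≤ η)
    (hL : 0 ≤ L) (hηL : η * L ≤ 1) {x : Vec d} {v : Ω → Vec d}
    (hv : HasMoments μ v (gradient F x) V) :
    ∫⁻ h, ENNReal.ofReal (F (x - η • v h) - B) ∂μ + ENNReal.ofReal (η / 2 * ‖gradient F x‖ ^ 2)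
      ≤ ENNReal.ofReal (F x - B) + ENNReal.ofReal (L * η ^ 2 / 2 * V) := by
  set a := gradient F x
  have hV := hv.nonneg
  set φ : Ω → ℝ := fun h => (F x - B) + (- η * inner ℝ a (v h) + L * η ^ 2 / 2 * ‖v h‖ ^ 2) with hφ
  have hle : ∀ h, F (x - η • v h) - B ≤ φ h := fun h => by
    have h1 := hF.le_quadratic x (-(η • v h))
    rw [inner_neg_right, inner_smul_right, norm_neg, norm_smul, mul_pow, Real.norm_eq_abs, sq_abs,
      ← sub_eq_add_neg] at h1
    simp only [hφ]
    linarith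
  have hφ0 : ∀ h, 0 ≤ φ h := fun h => (sub_nonneg.2 (hB _)).trans (hle h)
  have hi1 : Integrable (fun h => - η * inner ℝ a (v h)) μ := (hv.integrable.const_inner a).const_mul _
  have hi2 : Integrable (fun h => L * η ^ 2 / 2 * ‖v h‖ ^ 2) μ := by
    simpa using (hv.integrable_sq_sub 0).const_mul (L * η ^ 2 / 2)
  have hi3 : Integrable (fun h => - η * inner ℝ a (v h) + L * η ^ 2 / 2 * ‖v h‖ ^ 2) μ := hi1.add hi2
  have hi : Integrable φ μ := (integrable_const _).add hi3
  have hint : ∫ h, φ h ∂μ ≤ (F x - B) + L * η ^ 2 / 2 * V - η / 2 * ‖a‖ ^ 2 := by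
    have h1 : ∫ h, φ h ∂μ = (F x - B) + (- η * ‖a‖ ^ 2 + L * η ^ 2 / 2 * ∫ h, ‖v h‖ ^ 2 ∂μ) := by
      simp only [hφ]
      rw [integral_add (integrable_const _) hi3, integral_add hi1 hi2, integral_const_mul,
        integral_const_mul, integral_inner hv.integrable, hv.mean, real_inner_self_eq_norm_sq]
      simp
    have h2 : L * η ^ 2 / 2 * ∫ h, ‖v h‖ ^ 2 ∂μ ≤ L * η ^ 2 / 2 * (V + ‖a‖ ^ 2) := by
      gcongr; exact hv.integral_sq_le
    -- The step condition lets half of the first-order decrease `η ‖a‖²` absorb the squared mean in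
    -- the quadratic term.
    have h3 : η * L * η * ‖a‖ ^ 2 ≤ 1 * η * ‖a‖ ^ 2 := by gcongr
    rw [h1]
    nlinarith
  calc _ ≤ ENNReal.ofReal (∫ h, φ h ∂μ) + ENNReal.ofReal (η / 2 * ‖a‖ ^ 2) := by
        rw [ofReal_integral_eq_lintegral_ofReal hi (ae_of_all _ hφ0)]
        gcongr with h
        exact hle h
    _ = ENNReal.ofReal (∫ h, φ h ∂μ + η / 2 * ‖a‖ ^ 2) :=
        (ENNReal.ofReal_add (integral_nonneg hφ0) (by positivity)).symm
    _ ≤ ENNReal.ofReal ((F x - B) + L * η ^ 2 / 2 * V) := ENNReal.ofReal_le_ofReal (by linarith)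
    _ = _ := ENNReal.ofReal_add (sub_nonneg.2 (hB x)) (by positivity)

/-! ### Utility -/

lemma model_snoc (η : ℕ → ℝ) (x0 : Vec d) {t : ℕ} (h : Fin t → Fin n → Vec d) (v : Fin n → Vec d) :
    model η x0 (Fin.snoc (α := fun _ => Fin n → Vec d) h v : Fin (t + 1) → Fin n → Vec d)
      = model η x0 h - η t • ((1 / (n : ℝ)) • ∑ i, v i) := by
  simp only [model, Fin.sum_univ_castSucc, Fin.snoc_castSucc, Fin.snoc_last, Fin.val_castSucc,
    Fin.val_last]
  abel

variable {ω : ℝ}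

/-- The expectation of `F(x^t)` for a function `F ≥ 0`. -/
lemma lintegral_transcriptLaw_succ (f : Z → Vec d → ℝ) (D : Fin n → Fin m → Z) (b : ℕ) (η : ℕ → ℝ)
    (σ : ℝ) (C : ℕ → Fin n → Compressor d ω) (x0 : Vec d) (t : ℕ) {F : Vec d → ℝ≥0∞}
    (hF : Measurable F) :
    ∫⁻ h, F (model η x0 h) ∂(transcriptLaw f D b η σ C x0 (t + 1))
      = ∫⁻ h, ∫⁻ v, F (model η x0 h - η t • ((1 / (n : ℝ)) • ∑ i, v i))
          ∂(roundKernel f D b σ (C t) (model η x0 h)) ∂(transcriptLaw f D b η σ C x0 t) := by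
  have hm : Measurable fun h : Fin (t + 1) → Fin n → Vec d => F (model η x0 h) :=
    hF.comp (measurable_model η x0 (t + 1))
  rw [transcriptLaw, lintegral_map hm (measurable_snoc t),
    Measure.lintegral_compProd
      (f := fun p => F (model η x0 (Fin.snoc (α := fun _ => Fin n → Vec d) p.1 p.2)))
      (hm.comp (measurable_snoc t))]
  simp only [model_snoc, Kernel.comap_apply]

/-- Telescopes `IsSmooth.descent` along the transcript. The expectations of `F(x^t) - B` are kept as
`∫⁻`, and the inequalities free of subtraction, so integrability of `F(x^t)` never has to be shown.
-/
lemma avgSqGradNorm_le (hf : ∀ z, IsSmooth L (f z)) (hG : ∀ z, HasBoundedGradient G (f z))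
    (hn : 1 ≤ n) {b : ℕ} (hb : 1 ≤ b) (hbm : b ≤ m) (hω : 0 ≤ ω) (hL : 0 ≤ L)
    {η : ℝ} (hη : 0 < η) (hηL : η * L ≤ 1) (σ : ℝ) (C : ℕ → Fin n → Compressor d ω) (x0 : Vec d)
    (D : Fin n → Fin m → Z) {Δ : ℝ} (hbdd : BddBelow (Set.range (globalLoss f D)))
    (hΔ : globalLoss f D x0 - (⨅ x, globalLoss f D x) ≤ Δ) {T : ℕ} (hT : 1 ≤ T) :
    avgSqGradNorm f D b (fun _ => η) σ C x0 T
      ≤ 2 * Δ / (η * T) + L * η * ((1 + ω) * (2 * G ^ 2 + d * σ ^ 2) / n) := by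
  set F := globalLoss f D with hFdef
  set B := ⨅ x, F x
  set V := (1 + ω) * (2 * G ^ 2 + d * σ ^ 2) / n with hVdef
  have hm := hb.trans hbm
  have hV : 0 ≤ V := by positivity
  have hF := isSmooth_globalLoss hf D hn hm
  have hB : ∀ y, B ≤ F y := fun y => ciInf_le hbdd y
  have hΔ0 : 0 ≤ Δ := (sub_nonneg.2 (hB x0)).trans hΔ
  have hFm : Measurable F := hF.1.continuous.measurable
  have hgm : Measurable (gradient F) := measurable_gradient F
  have hmod := measurable_model (n := n) (fun _ => η) x0
  set P := fun t => transcriptLaw f D b (fun _ => η) σ C x0 t with hP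
  set a : ℕ → ℝ≥0∞ := fun t => ∫⁻ h, ENNReal.ofReal (F (model (fun _ => η) x0 h) - B) ∂(P t) with ha
  set g : ℕ → ℝ := fun t => ∫ h, ‖gradient F (model (fun _ => η) x0 h)‖ ^ 2 ∂(P t) with hg
  have hgi : ∀ t, Integrable (fun h => ‖gradient F (model (fun _ => η) x0 h)‖ ^ 2) (P t) := fun t => by
    refine Integrable.of_bound (C := G ^ 2) ?_ (ae_of_all _ fun h => ?_)
    · exact ((hgm.comp (hmod t)).norm.pow_const 2).aestronglyMeasurable
    · rw [Real.norm_of_nonneg (sq_nonneg _)]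
      gcongr
      exact norm_gradient_globalLoss_le hf hG D hn hm _
  have hg0 : ∀ t, 0 ≤ g t := fun t => integral_nonneg fun _ => sq_nonneg _
  have step : ∀ t, a (t + 1) + ENNReal.ofReal (η / 2 * g t)
      ≤ a t + ENNReal.ofReal (L * η ^ 2 / 2 * V) := fun t => by
    have h1 : ENNReal.ofReal (η / 2 * g t) = ∫⁻ h, ENNReal.ofReal
        (η / 2 * ‖gradient F (model (fun _ => η) x0 h)‖ ^ 2) ∂(P t) := by
      rw [hg, ← integral_const_mul, ofReal_integral_eq_lintegral_ofReal ((hgi t).const_mul _)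
        (ae_of_all _ fun h => by positivity)]
    have h2 : a (t + 1) = _ := lintegral_transcriptLaw_succ f D b (fun _ => η) σ C x0 t
      (F := fun x => ENNReal.ofReal (F x - B)) (by fun_prop)
    have hmg : Measurable fun h : Fin t → Fin n → Vec d =>
        ENNReal.ofReal (η / 2 * ‖gradient F (model (fun _ => η) x0 h)‖ ^ 2) :=
      (((hgm.comp (hmod t)).norm.pow_const 2).const_mul _).ennreal_ofReal
    rw [h1, h2, ← lintegral_add_right _ hmg]
    calc _ ≤ ∫⁻ h, ENNReal.ofReal (F (model (fun _ => η) x0 h) - B)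
            + ENNReal.ofReal (L * η ^ 2 / 2 * V) ∂(P t) := by
          refine lintegral_mono fun h => ?_
          refine hF.descent hB hη.le hL hηL ?_
          rw [(hasGradientAt_globalLoss hf D _).gradient]
          exact hasMoments_roundKernel hG D hn hb hbm σ hω (C t) _
      _ = _ := by rw [lintegral_add_right _ measurable_const, lintegral_const]; simp [ha, hP]
  have hsum : ∀ t, a t + ENNReal.ofReal (η / 2 * ∑ s ∈ Finset.range t, g s)
      ≤ ENNReal.ofReal Δ + ENNReal.ofReal (t * (L * η ^ 2 / 2 * V)) := fun t => by
    induction t with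
    | zero =>
      simp only [ha, hP, transcriptLaw, Finset.range_zero, Finset.sum_empty, mul_zero,
        ENNReal.ofReal_zero, add_zero, Nat.cast_zero, zero_mul]
      rw [lintegral_dirac]
      refine ENNReal.ofReal_le_ofReal ?_
      simpa [model] using hΔ
    | succ t ih =>
      have hs0 : 0 ≤ ∑ s ∈ Finset.range t, g s := Finset.sum_nonneg fun s _ => hg0 s
      have hgt := hg0 t
      rw [Finset.sum_range_succ, mul_add, ENNReal.ofReal_add (by positivity) (by positivity)]
      calc a (t + 1) + (ENNReal.ofReal (η / 2 * ∑ s ∈ Finset.range t, g s)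
            + ENNReal.ofReal (η / 2 * g t))
          = (a (t + 1) + ENNReal.ofReal (η / 2 * g t))
            + ENNReal.ofReal (η / 2 * ∑ s ∈ Finset.range t, g s) := by ring
        _ ≤ (a t + ENNReal.ofReal (L * η ^ 2 / 2 * V))
            + ENNReal.ofReal (η / 2 * ∑ s ∈ Finset.range t, g s) := add_le_add_left (step t) _
        _ = (a t + ENNReal.ofReal (η / 2 * ∑ s ∈ Finset.range t, g s))
            + ENNReal.ofReal (L * η ^ 2 / 2 * V) := by ring
        _ ≤ _ := by grw [ih]
        _ = _ := by
          rw [add_assoc, ← ENNReal.ofReal_add (by positivity) (by positivity)]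
          congr 2
          push_cast
          ring
  have hT0 : (0 : ℝ) < T := by exact_mod_cast hT
  have hfin : η / 2 * ∑ s ∈ Finset.range T, g s ≤ Δ + T * (L * η ^ 2 / 2 * V) := by
    rw [← ENNReal.ofReal_le_ofReal_iff (by positivity), ENNReal.ofReal_add hΔ0 (by positivity)]
    exact le_add_self.trans (hsum T)
  change (1 / (T : ℝ)) * ∑ s ∈ Finset.range T, g s ≤ _
  calc (1 / (T : ℝ)) * ∑ s ∈ Finset.range T, g s
      = 2 / (η * T) * (η / 2 * ∑ s ∈ Finset.range T, g s) := by field_simp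
    _ ≤ 2 / (η * T) * (Δ + T * (L * η ^ 2 / 2 * V)) := by gcongr
    _ = _ := by field_simp

lemma avgSqGradNorm_eq_zero (hf : ∀ z, IsSmooth 0 (f z)) (hn : 1 ≤ n) (hm : 1 ≤ m) (b : ℕ)
    (η : ℕ → ℝ) (σ : ℝ) (C : ℕ → Fin n → Compressor d ω) (x0 : Vec d) (D : Fin n → Fin m → Z)
    (hbdd : BddBelow (Set.range (globalLoss f D))) (T : ℕ) :
    avgSqGradNorm f D b η σ C x0 T = 0 := by
  have h := (isSmooth_globalLoss hf D hn hm).gradient_eq_zero hbdd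
  simp [avgSqGradNorm, h]

end

/-! ### The choice of the parameters -/

/-- The order of the Rényi divergence. -/
lemma exists_order {K ε l : ℝ} (hε : 0 < ε) (hl : 0 < l) (hεK : ε ≤ K * l) :
    ∃ α : ℕ, 2 ≤ α ∧ 2 * l ≤ ε * (α - 1) ∧ ε * α ≤ 2 * (2 + K) * l := by
  have hpos : 0 < 2 * l / ε := by positivity
  have h1 := Nat.le_ceil (2 * l / ε)
  have h2 := Nat.ceil_lt_add_one hpos.le
  have h3 : 1 ≤ ⌈2 * l / ε⌉₊ := Nat.one_le_ceil_iff.2 hpos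
  have h3' : (1 : ℝ) ≤ ⌈2 * l / ε⌉₊ := by exact_mod_cast h3
  have h4 : ε * (2 * l / ε) = 2 * l := mul_div_cancel₀ _ hε.ne'
  -- Then `ε α ≤ 2 l + 2 ε`, and `ε ≤ K l` bounds this by a multiple of `l`.
  refine ⟨⌈2 * l / ε⌉₊ + 1, by omega, ?_, ?_⟩
  · push_cast
    nlinarith
  · push_cast
    nlinarith

section

variable {Z : Type*} {d n m : ℕ} {L G ω : ℝ} {f : Z → Vec d → ℝ}

/-- The algorithm is private at the noise level `σ² = κ G² T log(1/δ) / (m² ε²)`. -/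
lemma isLDP_of_noise {K ε δ : ℝ} (hK : 0 < K) (hε : 0 < ε) (hδ : 0 < δ) (hδ1 : δ < 1)
    (hεK : ε ≤ K * Real.log (1 / δ)) {T : ℕ} (hT : 1 ≤ T) {b : ℕ} (hb : 1 ≤ b) (hbm : b ≤ m)
    (hbT : b = m ∨ ε ≤ ((b : ℝ) / m) ^ 2 * T) (hG0 : 0 < G) {σ : ℝ} (hσ : 0 < σ)
    (hσ2 : σ ^ 2 = 1120 * (2 + K) * G ^ 2 * T * Real.log (1 / δ) / (m ^ 2 * ε ^ 2))
    (hG : ∀ z, HasBoundedGradient G (f z)) (η : ℕ → ℝ) (C : ℕ → Fin n → Compressor d ω)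
    (x0 : Vec d) (D : Fin n → Fin m → Z) (i : Fin n) :
    IsLDP ε δ fun Di : Fin m → Z => transcriptLaw f (Function.update D i Di) b η σ C x0 T := by
  have hl : 0 < Real.log (1 / δ) := Real.log_pos (by rw [lt_div_iff₀ hδ]; linarith)
  obtain ⟨α, hα2, hα1, hαK⟩ := exists_order hε hl hεK
  set l := Real.log (1 / δ)
  have hT0 : (0 : ℝ) < T := by exact_mod_cast hT
  have hb0 : (0 : ℝ) < b := by exact_mod_cast hb
  have hm0 : (0 : ℝ) < m := by exact_mod_cast hb.trans hbm
  have hα' : (2 : ℝ) ≤ α := by exact_mod_cast hα2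
  refine isLDP_transcriptLaw hG hb hbm hσ hα2 (hbT.imp_right fun h => ?_) hδ T ?_ η C x0 D i
  -- Smallness of the one-round parameter: the minibatch condition reads `m² ε ≤ b² T`, and with `ε
  -- α ≤ 2 (2 + K) l` the quotient is at most `8 / 1120`.
  · have h1 : 4 * (G / (b * σ)) ^ 2 * α = 4 * (m ^ 2 * ε * (ε * α)) / (1120 * (2 + K) * b ^ 2 * T * l) := by
      rw [div_pow, mul_pow, hσ2]
      field_simp
    have h2 : (m : ℝ) ^ 2 * ε ≤ (b : ℝ) ^ 2 * T := by
      calc (m : ℝ) ^ 2 * ε ≤ (m : ℝ) ^ 2 * (((b : ℝ) / m) ^ 2 * T) := by gcongr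
        _ = (b : ℝ) ^ 2 * T := by field_simp
    rw [h1, div_le_one (by positivity)]
    calc 4 * (m ^ 2 * ε * (ε * α)) ≤ 4 * (b ^ 2 * T * (2 * (2 + K) * l)) := by gcongr
      _ = 8 * ((2 + K) * b ^ 2 * T * l) := by ring
      _ ≤ 1120 * ((2 + K) * b ^ 2 * T * l) := by gcongr; norm_num
      _ = _ := by ring
  -- With `1120 = 140 * 8` the total cost is at most `ε α / 4`. The budget suffices: `2 l ≤ ε (α -
  -- 1)` and `α ≥ 2` give `ε (α - 1) - l ≥ ε (α - 1) / 2 ≥ ε α / 4`.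
  · have h1 : 140 * α ^ 2 * (G / (m * σ)) ^ 2 * T = ε * α * (ε * α) / (8 * (2 + K) * l) := by
      rw [div_pow, mul_pow, hσ2]
      field_simp
      norm_num
    have h2 : ε * α * (ε * α) / (8 * (2 + K) * l) ≤ ε * α / 4 := by
      rw [div_le_iff₀ (by positivity)]
      calc ε * α * (ε * α) ≤ ε * α * (2 * (2 + K) * l) := by gcongr
        _ = _ := by ring
    rw [h1]
    nlinarith

/-- Write `U` for the utility order. The choice of `η` makes `2 Δ / (η T)` equal to `2 U`. Once `G²
≤ d σ²`, the variance factor is at most `3 (1 + ω) d σ² / n`, and the `T` in `σ²` cancels that in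
`η`, leaving `3 κ U`. -/
lemma avgSqGradNorm_le_utilityOrder {κ ε δ Δ : ℝ} (hκ : 1 ≤ κ) (hε : 0 < ε) (hδ : 0 < δ)
    (hδ1 : δ < 1) (hn : 1 ≤ n) (hd : 1 ≤ d) (hL : 0 < L) (hω : 0 ≤ ω) (hΔ : 0 < Δ) {T : ℕ}
    (hT : 1 ≤ T) (hR : roundOrder n m d L G ω ε δ Δ ≤ T) {b : ℕ} (hb : 1 ≤ b) (hbm : b ≤ m)
    (hG0 : 0 < G) {σ η : ℝ}
    (hσ2 : σ ^ 2 = κ * G ^ 2 * T * Real.log (1 / δ) / (m ^ 2 * ε ^ 2))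
    (hη : η = n * Δ * m * ε / (G * √((1 + ω) * d * Real.log (1 / δ)) * √(n * L * Δ) * T))
    (hf : ∀ z, IsSmooth L (f z))
    (hG : ∀ z, HasBoundedGradient G (f z)) (C : ℕ → Fin n → Compressor d ω)
    (x0 : Vec d) (D : Fin n → Fin m → Z) (hbdd : BddBelow (Set.range (globalLoss f D)))
    (hΔ' : globalLoss f D x0 - (⨅ x, globalLoss f D x) ≤ Δ) :
    avgSqGradNorm f D b (fun _ => η) σ C x0 T
      ≤ (2 + 3 * κ) * utilityOrder n m d L G ω ε δ Δ := by
  have hl : 0 < Real.log (1 / δ) := Real.log_pos (by rw [lt_div_iff₀ hδ]; linarith)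
  rw [roundOrder] at hR
  rw [utilityOrder]
  set l := Real.log (1 / δ)
  have hT0 : (0 : ℝ) < T := by exact_mod_cast hT
  have hm0 : (0 : ℝ) < m := by exact_mod_cast hb.trans hbm
  have hn0 : (0 : ℝ) < n := by exact_mod_cast hn
  have hd0 : (0 : ℝ) < d := by exact_mod_cast hd
  set p := √((1 + ω) * d * l) with hp
  set r := √(n * L * Δ) with hr
  have hp0 : 0 < p := Real.sqrt_pos.2 (by positivity)
  have hr0 : 0 < r := Real.sqrt_pos.2 (by positivity)
  have hp2 : p ^ 2 = (1 + ω) * d * l := Real.sq_sqrt (by positivity)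
  have hr2 : r ^ 2 = n * L * Δ := Real.sq_sqrt (by positivity)
  have hR1 : r * m * ε / (G * p) ≤ T := le_trans (le_add_of_nonneg_right (by positivity)) hR
  have hR2 : m ^ 2 * ε ^ 2 / (d * l) ≤ T := le_trans (le_add_of_nonneg_left (by positivity)) hR
  have hη0 : 0 < η := by rw [hη]; positivity
  have hηL : η * L ≤ 1 := by
    have h1 : η * L = r * m * ε / (G * p) / T := by
      rw [hη]
      field_simp
      linear_combination (-1 : ℝ) * hr2
    rw [h1]
    exact div_le_one_of_le₀ hR1 hT0.le
  have hsq : √((1 + ω) * L * Δ * d * l) = p * r / √n := by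
    rw [eq_div_iff (Real.sqrt_pos.2 hn0).ne', ← Real.sqrt_mul (by positivity), hp, hr,
      ← Real.sqrt_mul (by positivity)]
    congr 1
    ring
  have hu : G * √((1 + ω) * L * Δ * d * l) / (√n * m * ε) = G * p * r / (n * m * ε) := by
    have := Real.sq_sqrt hn0.le
    rw [hsq, ← this]
    have := Real.sqrt_pos.2 hn0
    rw [Real.sqrt_sq this.le]
    field_simp
  rw [hu]
  refine (avgSqGradNorm_le hf hG hn hb hbm hω hL.le hη0 hηL σ C x0 D hbdd hΔ' hT).trans ?_
  have hdσ : G ^ 2 ≤ d * σ ^ 2 := by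
    rw [div_le_iff₀ (by positivity)] at hR2
    rw [hσ2, ← mul_div_assoc, le_div_iff₀ (by positivity)]
    calc G ^ 2 * (m ^ 2 * ε ^ 2) ≤ G ^ 2 * (T * (d * l)) := by gcongr
      _ = 1 * (G ^ 2 * (T * (d * l))) := by ring
      _ ≤ κ * (G ^ 2 * (T * (d * l))) := by gcongr
      _ = _ := by ring
  have h1 : 2 * Δ / (η * T) = 2 * (G * p * r / (n * m * ε)) := by
    rw [hη]
    field_simp
  have h2 : L * η * ((1 + ω) * (3 * (d * σ ^ 2)) / n) = 3 * κ * (G * p * r / (n * m * ε)) := by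
    have e1 : L * Δ = r ^ 2 / n := by rw [hr2]; field_simp
    have e2 : L * η * ((1 + ω) * (3 * (d * σ ^ 2)) / n)
        = 3 * κ * ((L * Δ) * ((1 + ω) * d * l) * G / (p * r * m * ε)) := by
      rw [hη, hσ2]
      field_simp
    rw [e2, e1, ← hp2]
    field_simp
  rw [h1, add_mul 2 (3 * κ), ← h2]
  gcongr
  linarith

end

end CDPSGD

theorem mainTheorem3 (K : ℝ) (hK : 0 < K) :
    ∃ A : ℝ, 0 < A ∧ ∃ c : ℝ, 0 < c ∧
      ∀ (n m d : ℕ) (L G ω ε δ Δ : ℝ),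
        1 ≤ n → 1 ≤ m → 1 ≤ d → 0 ≤ L → 0 < G → 0 ≤ ω → 0 < Δ →
        0 < ε → 0 < δ → δ < 1 → ε ≤ K * Real.log (1 / δ) →
        ∃ (T : ℕ) (η σ : ℝ),
          1 ≤ T ∧
          CDPSGD.roundOrder n m d L G ω ε δ Δ / A ≤ T ∧
          T ≤ 1 + A * CDPSGD.roundOrder n m d L G ω ε δ Δ ∧
          0 < η ∧ 0 < σ ∧
          ∀ b : ℕ, 1 ≤ b → b ≤ m → (b = m ∨ ε ≤ c * ((b : ℝ) / m) ^ 2 * T) →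
            ∀ (Z : Type*) (f : Z → CDPSGD.Vec d → ℝ),
              (∀ z, CDPSGD.IsSmooth L (f z)) →
              (∀ z, CDPSGD.HasBoundedGradient G (f z)) →
              ∀ (C : ℕ → Fin n → CDPSGD.Compressor d ω) (x0 : CDPSGD.Vec d)
                (D : Fin n → Fin m → Z),
                (∀ i : Fin n, CDPSGD.IsLDP ε δ fun Di : Fin m → Z =>
                  CDPSGD.transcriptLaw f (Function.update D i Di) b (fun _ => η) σ C x0 T) ∧
                (BddBelow (Set.range (CDPSGD.globalLoss f D)) →
                  CDPSGD.globalLoss f D x0 - (⨅ x, CDPSGD.globalLoss f D x) ≤ Δ →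
                  CDPSGD.avgSqGradNorm f D b (fun _ => η) σ C x0 T
                    ≤ A * CDPSGD.utilityOrder n m d L G ω ε δ Δ) := by
  -- `A = 2 + 3 κ` with `κ = 1120 (2 + K)`, the constant in the noise level.
  refine ⟨2 + 3 * (1120 * (2 + K)), by positivity, 1, one_pos, ?_⟩
  intro n m d L G ω ε δ Δ hn hm hd hL hG0 hω hΔ hε hδ hδ1 hεK
  have hl : 0 < Real.log (1 / δ) := Real.log_pos (by rw [lt_div_iff₀ hδ]; linarith)
  have hm0 : (0 : ℝ) < m := by exact_mod_cast hm
  have hn0 : (0 : ℝ) < n := by exact_mod_cast hn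
  have hd0 : (0 : ℝ) < d := by exact_mod_cast hd
  set R := CDPSGD.roundOrder n m d L G ω ε δ Δ with hR
  have hR0 : 0 < R := by
    rw [hR, CDPSGD.roundOrder]
    positivity
  have hRT := Nat.le_ceil R
  have hT1 : 1 ≤ ⌈R⌉₊ := Nat.one_le_ceil_iff.2 hR0
  have hT0 : (0 : ℝ) < (⌈R⌉₊ : ℝ) := by exact_mod_cast hT1
  set T := ⌈R⌉₊
  set S : ℝ := 1120 * (2 + K) * G ^ 2 * T * Real.log (1 / δ) / (m ^ 2 * ε ^ 2) with hS
  have hS0 : 0 < S := by positivity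
  set η : ℝ := n * Δ * m * ε /
    (G * √((1 + ω) * d * Real.log (1 / δ)) * √(n * L * Δ) * T) with hη
  -- For `L = 0` the formula for `η` divides by zero and has the value `0`. Any positive step serves
  -- there: a function with constant gradient that is bounded below has zero gradient, so the
  -- utility vanishes.
  refine ⟨T, if L = 0 then 1 else η, √S, hT1, ?_, ?_, ?_, Real.sqrt_pos.2 hS0, ?_⟩
  · exact (div_le_self hR0.le (by linarith)).trans hRT
  · have := Nat.ceil_lt_add_one hR0.le
    have : 1 * R ≤ (2 + 3 * (1120 * (2 + K))) * R := by gcongr; linarith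
    linarith
  · split_ifs with h
    · exact one_pos
    · have := hL.lt_of_ne' h
      positivity
  intro b hb hbm hbT Z f hf hG C x0 D
  rw [one_mul] at hbT
  refine ⟨fun i => CDPSGD.isLDP_of_noise hK hε hδ hδ1 hεK hT1 hb hbm hbT hG0 (Real.sqrt_pos.2 hS0)
    (Real.sq_sqrt hS0.le) hG _ C x0 D i, fun hbdd hΔ' => ?_⟩
  rcases hL.eq_or_lt with rfl | hL0
  · rw [CDPSGD.avgSqGradNorm_eq_zero hf hn hm b _ _ C x0 D hbdd, CDPSGD.utilityOrder]
    positivity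
  · rw [if_neg hL0.ne']
    exact CDPSGD.avgSqGradNorm_le_utilityOrder (by linarith) hε hδ hδ1 hn hd hL0 hω hΔ hT1 hRT hb
      hbm hG0 (Real.sq_sqrt hS0.le) hη hf hG C x0 D hbdd hΔ'
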